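/- Let $m\ge 2$ and $r\ge 3$ be integers. An $r$-graph is a hypergraph all of whose edges are $r$-element sets of vertices. Let $C^r_{2m}$ denote the $r$-uniform linear cycle of length $2m$, that is, the $r$-graph (without isolated vertices) with edges $e_1,\dots,e_{2m}$ such that $|e_i\cap e_{i+1}|=1$ for $1\le i\le 2m-1$, $|e_{2m}\cap e_1|=1$, and $e_i\cap e_j=\emptyset$ for all other pairs $i\ne j$ (it is unique up to isomorphism). Let $K^r_t$ denote the complete $r$-graph on $t$ vertices. For $r$-graphs $G,H$, the Ramsey number $R(G,H)$ is the smallest positive integer $n$ such that every colouring of the edges of $K^r_n$ with the colours red and blue contains a red copy of $G$ or a blue copy of $H$. Then there is a constant $a_{m,r}>0$, depending only on $m$ and $r$, such that for every integer $t\ge 2$ $$R(C^r_{2m},K^r_t)\;\le\; a_{m,r}\left(\frac{t}{\ln t}\right)^{\frac{m}{m-1}} .$$ -/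

import Mathlib

namespace Hypergraph

/-- The complete `r`-graph `K^r_n`: its vertex set is the whole of `Fin n` and its edges are all
the `r`-element sets of vertices. -/
def completeUniform (r n : ℕ) : Hypergraph (Fin n) where
  vertexSet := Set.univ
  edgeSet := {e | e.ncard = r}
  subset_vertexSet_of_mem_edgeSet' := fun _ _ => Set.subset_univ _

/-- The `i`-th edge of the `r`-uniform linear cycle of length `ℓ`. The vertex `(i, 0)` is the
`i`-th core vertex, and the vertices `(i, j)` with `0 < j < r - 1` are the `r - 2` expansion vertices
of the `i`-th edge; the edge consists of the core vertices `(i, 0)` and `(i + 1, 0)` (indices mod `ℓ`)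
and of these expansion vertices. -/
def linearCycleEdge (r ℓ : ℕ) (i : ZMod ℓ) : Set (ZMod ℓ × Fin (r - 1)) :=
  {p | p.1 = i ∨ (p.1 = i + 1 ∧ (p.2 : ℕ) = 0)}

/-- The `r`-uniform linear cycle `C^r_ℓ` of length `ℓ` (meant for `ℓ ≥ 3` and `r ≥ 2`):
cyclically consecutive edges meet in exactly one vertex, all other pairs of edges are disjoint, and
every vertex lies on an edge. -/
def linearCycle (r ℓ : ℕ) : Hypergraph (ZMod ℓ × Fin (r - 1)) where
  vertexSet := Set.univ
  edgeSet := Set.range (linearCycleEdge r ℓ)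
  subset_vertexSet_of_mem_edgeSet' := fun _ _ => Set.subset_univ _

/-- `H` contains a copy of `G` as a (not necessarily induced) subgraph: there is a map of the
vertices of `G` to vertices of `H`, injective on the vertices of `G`, that sends every edge of `G`
to an edge of `H`. -/
def ContainsCopy {α β : Type*} (H : Hypergraph β) (G : Hypergraph α) : Prop :=
  ∃ f : α → β, Set.InjOn f G.vertexSet ∧ Set.MapsTo f G.vertexSet H.vertexSet ∧
    ∀ e ∈ G.edgeSet, f '' e ∈ H.edgeSet

/-- The colour class of colour `b` in a colouring `c` of the edges of `K^r_n` with two colours: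
the spanning subgraph of `K^r_n` whose edges are the edges of colour `b`. -/
def colorClass {r n : ℕ} (c : (completeUniform r n).edgeSet → Bool) (b : Bool) :
    Hypergraph (Fin n) where
  vertexSet := Set.univ
  edgeSet := {e | ∃ he : e ∈ (completeUniform r n).edgeSet, c ⟨e, he⟩ = b}
  subset_vertexSet_of_mem_edgeSet' := fun _ _ => Set.subset_univ _

/-- In every colouring of the edges of `K^r_n` with two colours (`true` is red, `false` is blue)
there is a red copy of `G` or a blue copy of `H`. -/
def RamseyArrow {α β : Type*} (r n : ℕ) (G : Hypergraph α) (H : Hypergraph β) : Prop :=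
  ∀ c : (completeUniform r n).edgeSet → Bool,
    (colorClass c true).ContainsCopy G ∨ (colorClass c false).ContainsCopy H

/-- `N` is the Ramsey number `R(G, H)` of the `r`-graphs `G` and `H`: the smallest positive integer
`n` such that every red-blue colouring of the edges of `K^r_n` has a red copy of `G` or a blue copy
of `H`. As a relation it also asserts that such an integer exists. -/
def IsRamseyNumber {α β : Type*} (r : ℕ) (G : Hypergraph α) (H : Hypergraph β) (N : ℕ) : Prop :=
  IsLeast {n : ℕ | 0 < n ∧ RamseyArrow r n G H} N

end Hypergraph

/-! Let `R` be the family of red edges on `n` vertices. If `R` has no linear cycle of length `2m`,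
it has an independent set of order `n ^ (1 - 1/m) * log n`
(`exists_independent_of_not_hasLinearCycle`), and such a set spans a blue complete `r`-graph. Taking
`n` of order `(t / log t) ^ (m / (m - 1))` makes this set have at least `t` vertices.

To find the independent set, `R` is replaced by its minimal sunflower kernels. Every edge contains
one, so a set containing no minimal kernel is independent. A kernel extends to an edge avoiding any
prescribed bounded set outside the kernel, so a linear cycle of kernels lifts to one in `R`
(`HasLinearCycle.of_isSunflowerKernel`). Minimality bounds the number of kernels through a pair
(`card_minimalKernels_superset_le`), so a Turán bound for closed walks whose steps avoid a sparse
conflict relation gives `O(n ^ (1 + 1/m))` kernels. The kernels of size two form a graph satisfying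
the same bound on every vertex subset; inside neighbourhoods this makes triangles rare. A random
sample with deletions destroys the triangles and the kernels of size at least three, and a
triangle-free graph of maximum degree at most `D` has an independent set larger by a factor of order
`log D` than the trivial one.

The Turán bound is spectral. With `T_k` the squared Frobenius norm of the `k`-th power of the
adjacency matrix, `T_k` is at most the number of closed walks of length `2k`. If all of these have a
conflict, Cauchy–Schwarz bounds `T_k` by a constant times `s * Δ * T_(k-1)`, where `Δ` bounds the
degrees and `s` the conflicting continuations; log-convexity turns this into an upper bound on the
average degree. -/

open Finset
open scoped Matrix

/-! ### Walk counts and Frobenius norms of adjacency powers. -/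

section ClosedWalks

variable {V : Type*} [Fintype V] [DecidableEq V]

/-- The walks with `l` steps in `G`, as sequences of vertices. -/
def SimpleGraph.walkSeqs (G : SimpleGraph V) [DecidableRel G.Adj] (l : ℕ) :
    Finset (Fin (l + 1) → V) :=
  {f | ∀ i : Fin l, G.Adj (f i.castSucc) (f i.succ)}

/-- A closed walk of length `ℓ` no two distinct steps of which are in conflict. -/
def SimpleGraph.HasConflictFreeCycle {V : Type*} (G : SimpleGraph V)
    (conf : V → V → V → V → Prop) (ℓ : ℕ) : Prop :=
  ∃ x : ZMod ℓ → V, (∀ i, G.Adj (x i) (x (i + 1))) ∧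
    ∀ i j, i ≠ j → ¬ conf (x i) (x (i + 1)) (x j) (x (j + 1))

theorem SimpleGraph.card_walkSeqs_eq_pow (G : SimpleGraph V) [DecidableRel G.Adj] (l : ℕ)
    (u v : V) :
    ((#{f ∈ G.walkSeqs l | f 0 = u ∧ f (Fin.last l) = v} : ℕ) : ℝ) =
      (G.adjMatrix ℝ ^ l) u v := by
  induction l generalizing v with
  | zero =>
    by_cases h : u = v
    · subst h
      have : ({f ∈ G.walkSeqs 0 | f 0 = u ∧ f (Fin.last 0) = u} : Finset (Fin 1 → V))
          = {fun _ => u} := by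
        ext f
        simp only [SimpleGraph.walkSeqs, mem_filter, mem_univ, true_and, mem_singleton]
        constructor
        · rintro ⟨_, h, _⟩
          funext i
          rw [Subsingleton.elim i 0, h]
        · rintro rfl
          simp
      rw [this]
      simp
    · have : ({f ∈ G.walkSeqs 0 | f 0 = u ∧ f (Fin.last 0) = v} : Finset (Fin 1 → V))
          = ∅ := by
        ext f
        simp only [mem_filter, notMem_empty, iff_false, not_and]
        intro _ h1 h2
        exact h (h1.symm.trans h2)
      rw [this]
      simp [Matrix.one_apply_ne h]
  | succ l ih =>
    rw [pow_succ, Matrix.mul_apply]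
    have hfib := Finset.card_eq_sum_card_fiberwise (s := {f ∈ G.walkSeqs (l + 1) | f 0 = u ∧ f (Fin.last (l + 1)) = v})
      (t := univ) (f := fun f => f (Fin.last l).castSucc) (by intro x _; simp)
    rw [hfib]
    push_cast
    refine Finset.sum_congr rfl fun w _ => ?_
    rw [← ih w, SimpleGraph.adjMatrix_apply]
    by_cases hw : G.Adj w v
    · simp only [hw, if_true, mul_one, Nat.cast_inj]
      refine Finset.card_bij' (fun f _ => Fin.init f) (fun f _ => Fin.snoc f v) ?_ ?_ ?_ ?_
      · intro f hf
        simp only [SimpleGraph.walkSeqs, mem_filter, mem_univ, true_and] at hf ⊢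
        obtain ⟨⟨h1, h2, h3⟩, h4⟩ := hf
        refine ⟨fun i => ?_, ?_, ?_⟩
        · have := h1 i.castSucc
          simpa [Fin.init] using this
        · simpa [Fin.init] using h2
        · simpa [Fin.init] using h4
      · intro f hf
        simp only [SimpleGraph.walkSeqs, mem_filter, mem_univ, true_and] at hf ⊢
        obtain ⟨h1, h2, h3⟩ := hf
        refine ⟨⟨fun i => ?_, ?_, ?_⟩, ?_⟩
        · induction i using Fin.lastCases with
          | last => simpa [h3] using hw
          | cast i =>
            rw [← Fin.castSucc_succ, Fin.snoc_castSucc, Fin.snoc_castSucc]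
            exact h1 i
        · have : (0 : Fin (l + 1 + 1)) = Fin.castSucc 0 := rfl
          rw [this, Fin.snoc_castSucc, h2]
        · simp
        · simpa using h3
      · intro f hf
        simp only [mem_filter] at hf
        rw [← hf.1.2.2]
        exact Fin.snoc_init_self f
      · intro f hf
        exact Fin.init_snoc _ _
    · simp only [hw, if_false, mul_zero, Nat.cast_eq_zero, card_eq_zero]
      ext f
      simp only [SimpleGraph.walkSeqs, mem_filter, mem_univ, true_and, notMem_empty, iff_false]
      rintro ⟨⟨h1, h2, h3⟩, h4⟩
      have := h1 (Fin.last l)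
      rw [Fin.succ_last, h3, h4] at this
      exact hw this

/-- The closed walks of length `ℓ`. -/
def SimpleGraph.closedSeqs (G : SimpleGraph V) [DecidableRel G.Adj] (ℓ : ℕ) [NeZero ℓ] :
    Finset (ZMod ℓ → V) :=
  {x | ∀ i, G.Adj (x i) (x (i + 1))}

/-- The squared Frobenius norm of the `j`-th power of the adjacency matrix. -/
noncomputable def SimpleGraph.frob (G : SimpleGraph V) [DecidableRel G.Adj] (j : ℕ) : ℝ :=
  ∑ u, ∑ v, ((G.adjMatrix ℝ ^ j) u v) ^ 2

theorem SimpleGraph.adjMatrix_pow_symm (G : SimpleGraph V) [DecidableRel G.Adj] (j : ℕ) (u v : V) :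
    (G.adjMatrix ℝ ^ j) u v = (G.adjMatrix ℝ ^ j) v u := by
  have h : (G.adjMatrix ℝ ^ j).transpose = G.adjMatrix ℝ ^ j := by
    rw [Matrix.transpose_pow, SimpleGraph.transpose_adjMatrix]
  conv_lhs => rw [← h]
  rfl

theorem SimpleGraph.frob_nonneg (G : SimpleGraph V) [DecidableRel G.Adj] (j : ℕ) :
    0 ≤ G.frob j :=
  Finset.sum_nonneg fun _ _ => Finset.sum_nonneg fun _ _ => sq_nonneg _

theorem SimpleGraph.frob_zero (G : SimpleGraph V) [DecidableRel G.Adj] :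
    G.frob 0 = Fintype.card V := by
  simp [SimpleGraph.frob, Matrix.one_apply]

theorem SimpleGraph.sum_pow_mul_pow (G : SimpleGraph V) [DecidableRel G.Adj] (a b : ℕ) :
    ∑ u, ∑ v, (G.adjMatrix ℝ ^ a) u v * (G.adjMatrix ℝ ^ b) u v =
      Matrix.trace (G.adjMatrix ℝ ^ (a + b)) := by
  rw [pow_add, Matrix.trace]
  refine Finset.sum_congr rfl fun u _ => ?_
  rw [Matrix.diag_apply, Matrix.mul_apply]
  refine Finset.sum_congr rfl fun v _ => ?_
  rw [G.adjMatrix_pow_symm b v u]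

/-- By symmetry of the matrix, the trace of `A ^ (2j + 2)` is also the inner product of `A ^ j` and
`A ^ (j + 2)`, to which Cauchy–Schwarz applies. -/
theorem SimpleGraph.frob_logConvex (G : SimpleGraph V) [DecidableRel G.Adj] (j : ℕ) :
    G.frob (j + 1) ^ 2 ≤ G.frob j * G.frob (j + 2) := by
  have h1 : G.frob (j + 1) =
      ∑ p : V × V, (G.adjMatrix ℝ ^ j) p.1 p.2 * (G.adjMatrix ℝ ^ (j + 2)) p.1 p.2 := by
    rw [Fintype.sum_prod_type, SimpleGraph.sum_pow_mul_pow]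
    simp only [SimpleGraph.frob, sq]
    rw [SimpleGraph.sum_pow_mul_pow]
    congr 2
    ring
  have h2 : ∀ j, G.frob j = ∑ p : V × V, ((G.adjMatrix ℝ ^ j) p.1 p.2) ^ 2 := by
    intro j
    rw [Fintype.sum_prod_type]; rfl
  rw [h1, h2 j, h2 (j + 2)]
  exact Finset.sum_mul_sq_le_sq_mul_sq _ _ _

/-- Log-convexity makes successive ratios nondecreasing, so a bound on the last ratio holds for all
earlier ones and telescopes down to `frob 0`. -/
theorem SimpleGraph.frob_le_pow (G : SimpleGraph V) [DecidableRel G.Adj] {ρ : ℝ} (hρ : 0 ≤ ρ)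
    (k : ℕ) (h : G.frob (k + 1) ≤ ρ * G.frob k) :
    G.frob (k + 1) ≤ ρ ^ (k + 1) * Fintype.card V := by
  induction k with
  | zero => simpa [SimpleGraph.frob_zero] using h
  | succ k ih =>
    have h1 : G.frob (k + 1) ≤ ρ * G.frob k := by
      rcases (G.frob_nonneg (k + 1)).eq_or_lt with h0 | h0
      · rw [← h0]; exact mul_nonneg hρ (G.frob_nonneg k)
      · have h2 := G.frob_logConvex k
        have h3 : G.frob (k + 1) * G.frob (k + 1) ≤ G.frob (k + 1) * (ρ * G.frob k) := by
          nlinarith [mul_le_mul_of_nonneg_left h (G.frob_nonneg k)]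
        exact le_of_mul_le_mul_left h3 h0
    calc G.frob (k + 1 + 1) ≤ ρ * G.frob (k + 1) := h
      _ ≤ ρ * (ρ ^ (k + 1) * Fintype.card V) := mul_le_mul_of_nonneg_left (ih h1) hρ
      _ = _ := by ring

/-- The Frobenius norm of a power of the adjacency matrix is at least the corresponding power of the
average degree. -/
theorem SimpleGraph.le_frob (G : SimpleGraph V) [DecidableRel G.Adj] {d : ℝ} (hd : 0 < d)
    [Nonempty V] (h : d * Fintype.card V ≤ ∑ v, (G.degree v : ℝ)) (k : ℕ) :
    d ^ (2 * k) ≤ G.frob k := by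
  -- The squared norms `W j` of `A ^ j 1` are log-convex as well. Their first ratio is at least `d ^
  -- 2` by Cauchy–Schwarz, hence so are all later ones.
  set w : ℕ → V → ℝ := fun j => (G.adjMatrix ℝ ^ j).mulVec 1 with hw
  set W : ℕ → ℝ := fun j => ∑ v, w j v ^ 2 with hW
  have hn : (0 : ℝ) < Fintype.card V := by exact_mod_cast Fintype.card_pos
  have hsymm : ∀ a b, ∑ v, w a v * w b v = ∑ v, w (a + b) v := by
    intro a b
    have h1 : ∀ j, (1 : V → ℝ) ᵥ* (G.adjMatrix ℝ ^ j) = (G.adjMatrix ℝ ^ j).mulVec 1 := by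
      intro j
      rw [← Matrix.mulVec_transpose, Matrix.transpose_pow, SimpleGraph.transpose_adjMatrix]
    have h2 : w a ⬝ᵥ w b = (1 : V → ℝ) ⬝ᵥ w (a + b) := by
      simp only [hw]
      rw [pow_add, ← Matrix.mulVec_mulVec, Matrix.dotProduct_mulVec (1 : V → ℝ), h1 a]
    simpa [dotProduct] using h2
  have hW0 : W 0 = Fintype.card V := by simp [hW, hw]
  have hlc : ∀ j, W (j + 1) ^ 2 ≤ W j * W (j + 2) := by
    intro j
    have : W (j + 1) = ∑ v, w j v * w (j + 2) v := by
      rw [hsymm]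
      simp only [hW, sq]
      rw [hsymm]
      refine Finset.sum_congr rfl fun v _ => ?_
      congr 1
      ring
    rw [this]
    exact Finset.sum_mul_sq_le_sq_mul_sq _ _ _
  have hw1 : ∀ v, w 1 v = G.degree v := by
    intro v
    simp [hw, Matrix.mulVec, dotProduct, SimpleGraph.adjMatrix_apply, SimpleGraph.degree,
      SimpleGraph.neighborFinset_eq_filter]
  have hstep0 : d ^ 2 * W 0 ≤ W 1 := by
    have h3 : (∑ v, w 1 v) ^ 2 ≤ Fintype.card V * W 1 := by
      simpa using sq_sum_le_card_mul_sum_sq (s := univ) (f := w 1)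
    have h4 : d * Fintype.card V ≤ ∑ v, w 1 v := by simpa [hw1] using h
    have h5 : (d * Fintype.card V) ^ 2 ≤ (∑ v, w 1 v) ^ 2 := by gcongr
    rw [hW0]
    have h6 : (Fintype.card V : ℝ) * (d ^ 2 * Fintype.card V) ≤ Fintype.card V * W 1 := by
      nlinarith
    exact le_of_mul_le_mul_left h6 hn
  have hboth : ∀ j, 0 < W j ∧ d ^ 2 * W j ≤ W (j + 1) := by
    intro j
    induction j with
    | zero => exact ⟨by rw [hW0]; exact hn, hstep0⟩
    | succ j ih =>
      have hpos : 0 < W (j + 1) := lt_of_lt_of_le (mul_pos (pow_pos hd 2) ih.1) ih.2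
      refine ⟨hpos, ?_⟩
      have h7 : W j * (d ^ 2 * W (j + 1)) ≤ W j * W (j + 2) := by
        nlinarith [hlc j, mul_le_mul_of_nonneg_right ih.2 hpos.le]
      exact le_of_mul_le_mul_left h7 ih.1
  have hWk : ∀ j, d ^ (2 * j) * Fintype.card V ≤ W j := by
    intro j
    induction j with
    | zero => simp [hW0]
    | succ j ih =>
      calc d ^ (2 * (j + 1)) * Fintype.card V = d ^ 2 * (d ^ (2 * j) * Fintype.card V) := by ring
        _ ≤ d ^ 2 * W j := by gcongr
        _ ≤ _ := (hboth j).2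
  -- Cauchy–Schwarz on each row of `A ^ k`; the factor `|V|` cancels against `W 0`.
  have hle : W k ≤ Fintype.card V * G.frob k := by
    simp only [hW, SimpleGraph.frob]
    rw [Finset.mul_sum]
    refine Finset.sum_le_sum fun u _ => ?_
    have : w k u = ∑ v, (G.adjMatrix ℝ ^ k) u v := by
      simp [hw, Matrix.mulVec, dotProduct]
    rw [this]
    simpa using sq_sum_le_card_mul_sum_sq (s := univ) (f := fun v => (G.adjMatrix ℝ ^ k) u v)
  have h8 : (Fintype.card V : ℝ) * d ^ (2 * k) ≤ Fintype.card V * G.frob k := by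
    linarith [hWk k]
  exact le_of_mul_le_mul_left h8 hn

end ClosedWalks

/-! ### Counting closed walks with a conflict. -/

section ConflictCounting

variable {V : Type*} [Fintype V] [DecidableEq V]

theorem ZMod.val_add_one_cases {ℓ : ℕ} [NeZero ℓ] (i : ZMod ℓ) :
    (i.val + 1 < ℓ ∧ (i + 1).val = i.val + 1) ∨ (i.val + 1 = ℓ ∧ (i + 1).val = 0) := by
  have h1 : ((i.val + 1 : ℕ) : ZMod ℓ) = i + 1 := by
    push_cast; rw [ZMod.natCast_zmod_val]
  rw [← h1, ZMod.val_natCast]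
  rcases lt_or_eq_of_le (Nat.succ_le_of_lt (ZMod.val_lt i)) with h | h
  · exact Or.inl ⟨h, Nat.mod_eq_of_lt h⟩
  · refine Or.inr ⟨h, ?_⟩
    have h' : i.val + 1 = ℓ := h
    rw [h', Nat.mod_self]

/-- Gluing two walks with `k` steps and exchanged ends gives a closed walk with `2k` steps. -/
theorem SimpleGraph.frob_le_card_closedSeqs (G : SimpleGraph V) [DecidableRel G.Adj] (k : ℕ)
    [NeZero (2 * k)] :
    G.frob k ≤ #(G.closedSeqs (2 * k)) := by
  have hk : 0 < 2 * k := Nat.pos_of_ne_zero (NeZero.ne _)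
  let P : Finset (Σ _ : V × V, (Fin (k + 1) → V) × (Fin (k + 1) → V)) :=
    univ.sigma fun p =>
      ({f ∈ G.walkSeqs k | f 0 = p.1 ∧ f (Fin.last k) = p.2}) ×ˢ
      ({f ∈ G.walkSeqs k | f 0 = p.2 ∧ f (Fin.last k) = p.1})
  have hP : G.frob k = #P := by
    simp only [P, card_sigma, card_product]
    push_cast
    rw [Fintype.sum_prod_type]
    refine Finset.sum_congr rfl fun u _ => Finset.sum_congr rfl fun v _ => ?_
    rw [SimpleGraph.card_walkSeqs_eq_pow, SimpleGraph.card_walkSeqs_eq_pow,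
      G.adjMatrix_pow_symm k v u, sq]
  rw [hP, Nat.cast_le]
  have hmem : ∀ a : (Σ _ : V × V, (Fin (k + 1) → V) × (Fin (k + 1) → V)), a ∈ P →
      (∀ i : Fin k, G.Adj (a.2.1 i.castSucc) (a.2.1 i.succ)) ∧ a.2.1 0 = a.1.1 ∧
      a.2.1 (Fin.last k) = a.1.2 ∧
      (∀ i : Fin k, G.Adj (a.2.2 i.castSucc) (a.2.2 i.succ)) ∧ a.2.2 0 = a.1.2 ∧
      a.2.2 (Fin.last k) = a.1.1 := by
    intro a ha
    simp only [P, mem_sigma, mem_univ, true_and, mem_product, mem_filter,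
      SimpleGraph.walkSeqs] at ha
    tauto
  -- Positions `0, …, k` come from the first walk and `k + 1, …, 2k - 1` from the interior of the
  -- second. The ends of the second walk are already ends of the first.
  let g : (Σ _ : V × V, (Fin (k + 1) → V) × (Fin (k + 1) → V)) → ZMod (2 * k) → V :=
    fun a i => if h : i.val ≤ k then a.2.1 ⟨i.val, by omega⟩
      else a.2.2 ⟨i.val - k, by have := ZMod.val_lt i; omega⟩
  refine Finset.card_le_card_of_injOn g ?_ ?_
  · intro a ha
    obtain ⟨h1, h2, h3, h4, h5, h6⟩ := hmem a ha
    simp only [SimpleGraph.closedSeqs, coe_filter, mem_univ, true_and, Set.mem_ofPred_eq]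
    intro i
    have hi := ZMod.val_lt i
    rcases ZMod.val_add_one_cases i with ⟨hlt, he⟩ | ⟨hlt, he⟩
    · rcases lt_trichotomy i.val k with hik | hik | hik
      · have e1 : g a i = a.2.1 (Fin.castSucc ⟨i.val, hik⟩) := by
          simp only [g]; rw [dif_pos hik.le]; rfl
        have e2 : g a (i + 1) = a.2.1 (Fin.succ ⟨i.val, hik⟩) := by
          simp only [g]; rw [dif_pos (by omega)]; refine congrArg _ (Fin.ext ?_); simp [he]
        rw [e1, e2]; exact h1 _
      · have hk0 : 0 < k := by omega
        have e1 : g a i = a.2.2 (Fin.castSucc ⟨0, hk0⟩) := by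
          simp only [g]; rw [dif_pos hik.le]
          have : (⟨i.val, by omega⟩ : Fin (k + 1)) = Fin.last k := by ext; simp [hik]
          rw [this, h3, ← h5]; rfl
        have e2 : g a (i + 1) = a.2.2 (Fin.succ ⟨0, hk0⟩) := by
          simp only [g]; rw [dif_neg (by omega)]; refine congrArg _ (Fin.ext ?_); simp [he, hik]
        rw [e1, e2]; exact h4 _
      · have e1 : g a i = a.2.2 (Fin.castSucc ⟨i.val - k, by omega⟩) := by
          simp only [g]; rw [dif_neg (by omega)]; rfl
        have e2 : g a (i + 1) = a.2.2 (Fin.succ ⟨i.val - k, by omega⟩) := by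
          simp only [g]; rw [dif_neg (by omega)]; refine congrArg _ (Fin.ext ?_); simp [he]; omega
        rw [e1, e2]; exact h4 _
    · have hk0 : 0 < k := by omega
      have e2 : g a (i + 1) = a.1.1 := by
        simp only [g]; rw [dif_pos (by omega), ← h2]; refine congrArg _ (Fin.ext ?_); simp [he]
      rw [e2]
      -- Only for `k = 1` does the last position `2k - 1` lie in the first walk.
      by_cases hik : i.val ≤ k
      · have hk1 : k = 1 := by omega
        have e1 : g a i = a.2.2 (Fin.castSucc ⟨0, hk0⟩) := by
          simp only [g]; rw [dif_pos hik]
          have : (⟨i.val, by omega⟩ : Fin (k + 1)) = Fin.last k := by ext; simp; omega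
          rw [this, h3, ← h5]; rfl
        have e3 : a.1.1 = a.2.2 (Fin.succ ⟨0, hk0⟩) := by
          rw [← h6]; refine congrArg _ (Fin.ext ?_); simp [hk1]
        rw [e1, e3]; exact h4 _
      · have e1 : g a i = a.2.2 (Fin.castSucc ⟨i.val - k, by omega⟩) := by
          simp only [g]; rw [dif_neg (by omega)]; rfl
        have e3 : a.1.1 = a.2.2 (Fin.succ ⟨i.val - k, by omega⟩) := by
          rw [← h6]; refine congrArg _ (Fin.ext ?_); simp; omega
        rw [e1, e3]; exact h4 _
  · intro a ha b hb hab
    obtain ⟨h1, h2, h3, h4, h5, h6⟩ := hmem a ha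
    obtain ⟨h1', h2', h3', h4', h5', h6'⟩ := hmem b hb
    have hv : ∀ n < 2 * k, ((n : ℕ) : ZMod (2 * k)).val = n := fun n hn => ZMod.val_natCast_of_lt hn
    have E1 : a.2.1 = b.2.1 := by
      funext j
      have hj : (j : ℕ) < 2 * k := by have := j.2; omega
      have := congrFun hab ((j : ℕ) : ZMod (2 * k))
      have hj' : (j : ℕ) ≤ k := by have := j.2; omega
      simpa [g, hv _ hj, hj'] using this
    have E2 : a.1 = b.1 := by
      ext
      · rw [← h2, ← h2', E1]
      · rw [← h3, ← h3', E1]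
    have E3 : a.2.2 = b.2.2 := by
      funext j
      have hj0 := j.2
      rcases Nat.eq_zero_or_pos (j : ℕ) with hj | hj
      · have : j = 0 := by ext; simpa using hj
        rw [this, h5, h5', E2]
      · rcases eq_or_ne (j : ℕ) k with hjk | hjk
        · have : j = Fin.last k := by ext; simpa using hjk
          rw [this, h6, h6', E2]
        · have := congrFun hab ((k + j : ℕ) : ZMod (2 * k))
          simp only [g, hv (k + j) (by omega)] at this
          rw [dif_neg (by omega), dif_neg (by omega)] at this
          simpa using this
    rcases a with ⟨a1, a2, a3⟩
    rcases b with ⟨b1, b2, b3⟩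
    simp only at E1 E2 E3
    subst E1 E2 E3
    rfl

/-- Closed walks in which the step number `k` is in conflict with one of the `k` steps before. -/
theorem SimpleGraph.card_conflict_le (G : SimpleGraph V) [DecidableRel G.Adj] (j : ℕ)
    [NeZero (2 * (j + 1))] (conf : V → V → V → V → Prop) [∀ a b c d, Decidable (conf a b c d)]
    {s Δ : ℕ} (hs : ∀ u u' w, G.Adj u u' → #{z | G.Adj w z ∧ conf u u' w z} ≤ s)
    (hΔ : ∀ v, G.degree v ≤ Δ) :
    (#{x ∈ G.closedSeqs (2 * (j + 1)) | ∃ i : Fin (j + 1),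
        conf (x ((i : ℕ) : ZMod _)) (x ((i : ℕ) + 1)) (x ((j + 1 : ℕ) : ZMod _))
          (x (((j + 1 : ℕ) : ZMod _) + 1))} : ℝ) ≤
      √((j + 1) * s * Δ * (G.frob (j + 1) * G.frob j)) := by
  classical
  let N : ℕ → V → V → ℝ := fun l u v => (G.adjMatrix ℝ ^ l) u v
  -- With `k = j + 1`, the closed walk is cut into its first `k` steps `ω`, a conflicting step to
  -- `y`, and `j` steps from `y` back to the start.
  let badset : (Fin (j + 1 + 1) → V) → Finset V := fun ω =>
    {y | G.Adj (ω (Fin.last _)) y ∧ ∃ i : Fin (j + 1),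
      conf (ω i.castSucc) (ω i.succ) (ω (Fin.last _)) y}
  let Q : Finset (Σ _ : (Fin (j + 1 + 1) → V), Σ _ : V, (Fin (j + 1) → V)) :=
    (G.walkSeqs (j + 1)).sigma fun ω => (badset ω).sigma fun y =>
      {f ∈ G.walkSeqs j | f 0 = y ∧ f (Fin.last j) = ω 0}
  have hQ : (#Q : ℝ) = ∑ ω ∈ G.walkSeqs (j + 1), ∑ y ∈ badset ω, N j y (ω 0) := by
    simp only [Q, card_sigma]
    push_cast
    refine Finset.sum_congr rfl fun ω _ => Finset.sum_congr rfl fun y _ => ?_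
    rw [SimpleGraph.card_walkSeqs_eq_pow]
  have hle : #{x ∈ G.closedSeqs (2 * (j + 1)) | ∃ i : Fin (j + 1),
        conf (x ((i : ℕ) : ZMod _)) (x ((i : ℕ) + 1)) (x ((j + 1 : ℕ) : ZMod _))
          (x (((j + 1 : ℕ) : ZMod _) + 1))} ≤ #Q := by
    let φ : (ZMod (2 * (j + 1)) → V) → (Σ _ : (Fin (j + 1 + 1) → V), Σ _ : V, (Fin (j + 1) → V)) :=
      fun x => ⟨fun i => x ((i : ℕ) : ZMod _), x (((j + 1 : ℕ) : ZMod _) + 1),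
        fun i => x ((j + 1 + 1 + i : ℕ) : ZMod _)⟩
    refine Finset.card_le_card_of_injOn φ ?_ ?_
    · intro x hx
      simp only [SimpleGraph.closedSeqs, coe_filter, mem_filter, mem_univ, true_and,
        Set.mem_ofPred_eq] at hx
      obtain ⟨hadj, i, hi⟩ := hx
      simp only [Q, φ, badset, SimpleGraph.walkSeqs, coe_sigma, Set.mem_sigma_iff, mem_coe,
        mem_filter, mem_univ, true_and]
      refine ⟨?_, ⟨?_, i, ?_⟩, ?_, ?_, ?_⟩
      · intro i
        have := hadj ((i : ℕ) : ZMod _)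
        simpa using this
      · have := hadj ((j + 1 : ℕ) : ZMod _)
        simpa using this
      · simpa using hi
      · intro i
        have := hadj ((j + 1 + 1 + i : ℕ) : ZMod _)
        simpa [add_assoc] using this
      · simp
      · have : ((j + 1 + 1 + j : ℕ) : ZMod (2 * (j + 1))) = 0 := by
          have : j + 1 + 1 + j = 2 * (j + 1) := by ring
          rw [this]; exact ZMod.natCast_self _
        simpa using congrArg x this
    · intro x _ y _ hxy
      simp only [φ, Sigma.mk.injEq, heq_eq_eq] at hxy
      obtain ⟨h1, _, h3⟩ := hxy
      funext i
      have hi := ZMod.val_lt i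
      rw [← ZMod.natCast_zmod_val i]
      by_cases h : i.val < j + 1 + 1
      · exact congrFun h1 ⟨i.val, h⟩
      · have := congrFun h3 ⟨i.val - (j + 1 + 1), by omega⟩
        simp only at this
        have e : j + 1 + 1 + (i.val - (j + 1 + 1)) = i.val := by omega
        rwa [e] at this
  have hbad : ∀ ω ∈ G.walkSeqs (j + 1), #(badset ω) ≤ (j + 1) * s := by
    intro ω hω
    have hω' : ∀ i : Fin (j + 1), G.Adj (ω i.castSucc) (ω i.succ) := by
      simpa [SimpleGraph.walkSeqs] using hω
    have : badset ω ⊆ univ.biUnion fun i : Fin (j + 1) =>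
        {y | G.Adj (ω (Fin.last _)) y ∧ conf (ω i.castSucc) (ω i.succ) (ω (Fin.last _)) y} := by
      intro y hy
      simp only [badset, mem_filter, mem_univ, true_and, mem_biUnion] at hy ⊢
      obtain ⟨h1, i, h2⟩ := hy
      exact ⟨i, h1, h2⟩
    refine (card_le_card this).trans (card_biUnion_le.trans ?_)
    refine (Finset.sum_le_sum fun i _ => hs _ _ _ (hω' i)).trans ?_
    simp
  -- Cauchy–Schwarz over the at most `(j + 1) * s` bad vertices, followed by enlarging the bad set
  -- to the whole neighbourhood, leaves a quantity depending only on the ends of `ω`. The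
  -- enlargement costs the factor `Δ` in `hg2`.
  let g : V → V → ℝ := fun u v => √(∑ y ∈ G.neighborFinset v, N j y u ^ 2)
  have hinner : ∀ ω ∈ G.walkSeqs (j + 1),
      ∑ y ∈ badset ω, N j y (ω 0) ≤ √((j + 1) * s) * g (ω 0) (ω (Fin.last _)) := by
    intro ω hω
    have h1 : (∑ y ∈ badset ω, N j y (ω 0)) ≤
        √(∑ y ∈ badset ω, (1 : ℝ) ^ 2) * √(∑ y ∈ badset ω, N j y (ω 0) ^ 2) := by
      simpa using Real.sum_mul_le_sqrt_mul_sqrt (badset ω) (fun _ => (1 : ℝ)) (fun y => N j y (ω 0))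
    refine h1.trans ?_
    gcongr
    · have := hbad ω hω
      simp only [one_pow, sum_const, nsmul_eq_mul, mul_one]
      exact_mod_cast this
    · refine Real.sqrt_le_sqrt (Finset.sum_le_sum_of_subset_of_nonneg ?_ fun _ _ _ => sq_nonneg _)
      intro y hy
      simp only [badset, mem_filter, mem_univ, true_and] at hy
      simpa using hy.1
  have hgroup : ∑ ω ∈ G.walkSeqs (j + 1), g (ω 0) (ω (Fin.last _)) =
      ∑ p : V × V, N (j + 1) p.1 p.2 * g p.1 p.2 := by
    rw [← Finset.sum_fiberwise_of_maps_to (s := G.walkSeqs (j + 1)) (t := univ)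
      (g := fun ω => (ω 0, ω (Fin.last _))) (fun _ _ => mem_univ _)]
    refine Finset.sum_congr rfl fun p _ => ?_
    have : ∀ ω ∈ ({ω ∈ G.walkSeqs (j + 1) | (ω 0, ω (Fin.last _)) = p} : Finset _),
        g (ω 0) (ω (Fin.last _)) = g p.1 p.2 := by
      intro ω hω
      rw [mem_filter] at hω
      rw [← hω.2]
    rw [Finset.sum_congr rfl this, sum_const, nsmul_eq_mul]
    simp only [N]
    rw [← SimpleGraph.card_walkSeqs_eq_pow]
    congr 3
    ext ω
    simp [Prod.ext_iff]
  have hg2 : ∑ p : V × V, g p.1 p.2 ^ 2 ≤ Δ * G.frob j := by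
    have h1 : ∀ p : V × V, g p.1 p.2 ^ 2 = ∑ y, if G.Adj p.2 y then N j y p.1 ^ 2 else 0 := by
      intro p
      simp only [g]
      rw [Real.sq_sqrt (Finset.sum_nonneg fun _ _ => sq_nonneg _),
        SimpleGraph.neighborFinset_eq_filter, Finset.sum_filter]
    rw [Finset.sum_congr rfl fun p _ => h1 p, Fintype.sum_prod_type]
    simp only [SimpleGraph.frob]
    rw [Finset.sum_comm' (t' := univ) (s' := fun _ => univ) (by simp), Finset.mul_sum]
    rw [Finset.sum_comm' (t' := univ) (s' := fun _ => univ) (by simp)]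
    have h2 : ∀ u, ∑ v, (∑ y, if G.Adj v y then N j y u ^ 2 else 0) ≤ Δ * ∑ y, N j u y ^ 2 := by
      intro u
      rw [Finset.sum_comm, Finset.mul_sum]
      refine Finset.sum_le_sum fun y _ => ?_
      rw [← Finset.sum_filter, sum_const, nsmul_eq_mul]
      have h3 : #{v | G.Adj v y} = G.degree y := by
        rw [← SimpleGraph.card_neighborFinset_eq_degree, SimpleGraph.neighborFinset_eq_filter]
        congr 1
        ext v
        simp [G.adj_comm]
      have h4 : N j y u = N j u y := G.adjMatrix_pow_symm _ _ _
      rw [h3, h4]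
      have := hΔ y
      gcongr
    exact Finset.sum_le_sum fun u _ => h2 u
  have hfrob : ∑ p : V × V, N (j + 1) p.1 p.2 ^ 2 = G.frob (j + 1) := by
    rw [Fintype.sum_prod_type]; rfl
  have hcs := Real.sum_mul_le_sqrt_mul_sqrt (univ : Finset (V × V))
    (fun p => N (j + 1) p.1 p.2) (fun p => g p.1 p.2)
  calc _ ≤ (#Q : ℝ) := by exact_mod_cast hle
    _ ≤ ∑ ω ∈ G.walkSeqs (j + 1), √((j + 1) * s) * g (ω 0) (ω (Fin.last _)) := by
        rw [hQ]; exact Finset.sum_le_sum hinner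
    _ = √((j + 1) * s) * ∑ p : V × V, N (j + 1) p.1 p.2 * g p.1 p.2 := by
        rw [← Finset.mul_sum, hgroup]
    _ ≤ √((j + 1) * s) * (√(G.frob (j + 1)) * √(Δ * G.frob j)) := by
        gcongr
        refine hcs.trans ?_
        rw [hfrob]
        gcongr
    _ = _ := by
        rw [← Real.sqrt_mul (G.frob_nonneg _), ← Real.sqrt_mul (by positivity)]
        congr 1
        ring

/-- An almost regular graph in which the average degree is large contains a conflict-free cycle. -/
theorem SimpleGraph.pow_le_of_not_hasConflictFreeCycle [Nonempty V] (G : SimpleGraph V)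
    [DecidableRel G.Adj] (k : ℕ)
    (hk : 0 < k) (conf : V → V → V → V → Prop) (hsymm : ∀ a b c d, conf a b c d → conf c d a b)
    {s Δ : ℕ} (hs : ∀ u u' w, G.Adj u u' → {z | G.Adj w z ∧ conf u u' w z}.ncard ≤ s)
    (hΔ : ∀ v, G.degree v ≤ Δ) {d : ℝ} (hd : 0 < d)
    (havg : d * Fintype.card V ≤ ∑ v, (G.degree v : ℝ))
    (hno : ¬ G.HasConflictFreeCycle conf (2 * k)) :
    d ^ (2 * k) ≤ (4 * k ^ 3 * s * Δ) ^ k * Fintype.card V := by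
  classical
  obtain ⟨j, rfl⟩ : ∃ j, k = j + 1 := ⟨k - 1, by omega⟩
  have : NeZero (2 * (j + 1)) := ⟨by omega⟩
  have hs' : ∀ u u' w, G.Adj u u' → #{z | G.Adj w z ∧ conf u u' w z} ≤ s := by
    intro u u' w h
    have := hs u u' w h
    rwa [Set.ncard_eq_toFinset_card', Set.toFinset_ofPred] at this
  set B := ({x ∈ G.closedSeqs (2 * (j + 1)) | ∃ i : Fin (j + 1),
        conf (x ((i : ℕ) : ZMod _)) (x ((i : ℕ) + 1)) (x ((j + 1 : ℕ) : ZMod _))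
          (x (((j + 1 : ℕ) : ZMod _) + 1))} : Finset _) with hB
  have hBle := G.card_conflict_le j conf hs' hΔ
  rw [← hB] at hBle
  -- Every closed walk has a conflict. A rotation puts the later of the two steps at position `j +
  -- 1`; the other then lies among the preceding `j + 1` steps, since one of the two cyclic
  -- distances is at most half the length.
  have hcover : G.closedSeqs (2 * (j + 1)) ⊆ (univ : Finset (ZMod (2 * (j + 1)))).biUnion
      fun t => B.image fun x i => x (i + t) := by
    intro x hx
    have hadj : ∀ i, G.Adj (x i) (x (i + 1)) := by
      simpa [SimpleGraph.closedSeqs] using hx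
    have : ∃ i j', i ≠ j' ∧ conf (x i) (x (i + 1)) (x j') (x (j' + 1)) := by
      by_contra hcon
      push Not at hcon
      exact hno ⟨x, hadj, fun i j' h => hcon i j' h⟩
    have key : ∀ a b : ZMod (2 * (j + 1)), a ≠ b → conf (x a) (x (a + 1)) (x b) (x (b + 1)) →
        (b - a).val ≤ j + 1 → ∃ t, ∃ y ∈ B, (fun i => y (i + t)) = x := by
      intro a b hab hc hval
      set t : ZMod (2 * (j + 1)) := b - ((j + 1 : ℕ) : ZMod _) with ht
      refine ⟨-t, fun i => x (i + t), ?_, ?_⟩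
      · rw [hB, mem_filter]
        refine ⟨?_, ?_⟩
        · simp only [SimpleGraph.closedSeqs, mem_filter, mem_univ, true_and]
          intro i
          have := hadj (i + t)
          rwa [show i + t + 1 = i + 1 + t by ring] at this
        · have hpos : 0 < (b - a).val := by
            rw [Nat.pos_iff_ne_zero, Ne, ZMod.val_eq_zero, sub_eq_zero]
            exact fun h => hab h.symm
          refine ⟨⟨j + 1 - (b - a).val, by omega⟩, ?_⟩
          have e1 : ((j + 1 - (b - a).val : ℕ) : ZMod (2 * (j + 1))) + t = a := by
            rw [Nat.cast_sub hval, ZMod.natCast_zmod_val, ht]; ring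
          have e2 : ((j + 1 : ℕ) : ZMod (2 * (j + 1))) + t = b := by rw [ht]; ring
          have e3 : ((j + 1 - (b - a).val : ℕ) : ZMod (2 * (j + 1))) + 1 + t = a + 1 := by
            rw [add_right_comm, e1]
          have e4 : ((j + 1 : ℕ) : ZMod (2 * (j + 1))) + 1 + t = b + 1 := by
            rw [add_right_comm, e2]
          simp only [e1, e2, e3, e4]
          exact hc
      · funext i
        simp
    have : ∃ t, ∃ y ∈ B, (fun i => y (i + t)) = x := by
      obtain ⟨a, b, hab, hc⟩ := this
      by_cases h : (b - a).val ≤ j + 1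
      · exact key a b hab hc h
      · refine key b a hab.symm (hsymm _ _ _ _ hc) ?_
        have hne : NeZero (b - a) := ⟨fun h0 => hab (sub_eq_zero.1 h0).symm⟩
        have := ZMod.val_neg_of_ne_zero (b - a)
        rw [neg_sub] at this
        omega
    obtain ⟨t, y, hy, hyx⟩ := this
    exact mem_biUnion.2 ⟨t, mem_univ _, mem_image.2 ⟨y, hy, hyx⟩⟩
  have hcard : (#(G.closedSeqs (2 * (j + 1))) : ℝ) ≤ 2 * (j + 1) * #B := by
    have h1 := (card_le_card hcover).trans (card_biUnion_le_card_mul _ _ #B fun t _ => card_image_le)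
    rw [Finset.card_univ, ZMod.card] at h1
    exact_mod_cast h1
  set T := G.frob (j + 1) with hT
  set T' := G.frob j with hT'
  have hTn : 0 ≤ T := G.frob_nonneg _
  have hTn' : 0 ≤ T' := G.frob_nonneg _
  have h1 : T ≤ 2 * (j + 1) * √((j + 1) * s * Δ * (T * T')) := by
    refine (G.frob_le_card_closedSeqs (j + 1)).trans (hcard.trans ?_)
    gcongr
  have h2 : T ≤ (4 * (j + 1) ^ 3 * s * Δ) * T' := by
    -- Squaring `h1` gives an extra factor `T`, cancelled when `T` is positive.
    rcases hTn.eq_or_lt with h0 | h0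
    · rw [← h0]; positivity
    · have h3 : T ^ 2 ≤ (2 * (j + 1) * √((j + 1) * s * Δ * (T * T'))) ^ 2 := by gcongr
      rw [mul_pow, Real.sq_sqrt (by positivity)] at h3
      have h4 : T * T ≤ T * ((4 * (j + 1) ^ 3 * s * Δ) * T') := by
        linarith [h3]
      exact le_of_mul_le_mul_left h4 h0
  have h5 := G.frob_le_pow (by positivity) j h2
  have h6 := G.le_frob hd havg (j + 1)
  push_cast
  exact h6.trans h5

end ConflictCounting

/-! ### Passage to an almost regular subgraph and the Turán bound. -/

section Turan

/-- The number of ordered pairs of adjacent vertices with the first one in `A` and the second one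
in `B`. -/
def SimpleGraph.dartCount {V : Type*} (G : SimpleGraph V) [DecidableRel G.Adj] (A B : Finset V) :
    ℕ := ∑ v ∈ A, #{z ∈ B | G.Adj v z}

section

variable {V : Type*} (G : SimpleGraph V) [DecidableRel G.Adj]

theorem SimpleGraph.dartCount_comm (A B : Finset V) : G.dartCount A B = G.dartCount B A := by
  have h := Finset.sum_card_bipartiteAbove_eq_sum_card_bipartiteBelow (s := A) (t := B) G.Adj
  simp only [Finset.bipartiteAbove, Finset.bipartiteBelow] at h
  simp only [SimpleGraph.dartCount]
  rw [h]
  simp only [G.adj_comm]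

theorem SimpleGraph.dartCount_mono {A A' B B' : Finset V} (hA : A ⊆ A') (hB : B ⊆ B') :
    G.dartCount A B ≤ G.dartCount A' B' :=
  (Finset.sum_le_sum fun _ _ => card_le_card (filter_subset_filter _ hB)).trans
    (Finset.sum_le_sum_of_subset hA)

theorem SimpleGraph.dartCount_le_sq (A : Finset V) : G.dartCount A A ≤ #A ^ 2 := by
  refine (Finset.sum_le_card_nsmul _ _ #A fun v _ => card_filter_le _ _).trans ?_
  rw [smul_eq_mul, sq]

theorem SimpleGraph.dartCount_sdiff_add [DecidableEq V] {A B : Finset V} (h : B ⊆ A) (D : Finset V) :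
    G.dartCount (A \ B) D + G.dartCount B D = G.dartCount A D :=
  Finset.sum_sdiff h

/-- The version of `SimpleGraph.pow_le_of_not_hasConflictFreeCycle` for induced subgraphs. -/
theorem SimpleGraph.pow_le_dartCount_of_not_hasConflictFreeCycle [DecidableEq V]
    {k : ℕ} (hk : 0 < k) {conf : V → V → V → V → Prop}
    (hsymm : ∀ a b c d, conf a b c d → conf c d a b)
    {s Δ : ℕ} (W : Finset V) (hW : W.Nonempty)
    (hs : ∀ u u' w, G.Adj u u' → {z | z ∈ W ∧ G.Adj w z ∧ conf u u' w z}.ncard ≤ s)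
    (hΔ : ∀ v ∈ W, #{z ∈ W | G.Adj v z} ≤ Δ) {d : ℝ} (hd : 0 < d)
    (havg : d * #W ≤ G.dartCount W W) (hno : ¬ G.HasConflictFreeCycle conf (2 * k)) :
    d ^ (2 * k) ≤ (4 * k ^ 3 * s * Δ) ^ k * #W := by
  have : Nonempty W := hW.to_subtype
  let H : SimpleGraph W := G.comap Subtype.val
  have hdeg : ∀ v : W, H.degree v = #{z ∈ W | G.Adj v z} := by
    intro v
    rw [← SimpleGraph.card_neighborFinset_eq_degree, SimpleGraph.neighborFinset_eq_filter]
    refine Finset.card_bij (fun z _ => z.1) ?_ ?_ ?_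
    · intro z hz
      simpa [H] using hz
    · intro z _ z' _ h
      exact Subtype.ext h
    · intro z hz
      rw [mem_filter] at hz
      exact ⟨⟨z, hz.1⟩, by simpa [H] using hz.2, rfl⟩
  have := H.pow_le_of_not_hasConflictFreeCycle k hk (fun a b c d => conf a b c d)
    (fun _ _ _ _ h => hsymm _ _ _ _ h) (s := s) (Δ := Δ) ?_ ?_ hd ?_ ?_
  · simpa using this
  · intro u u' w huu'
    refine le_trans ?_ (hs u u' w huu')
    refine Set.ncard_le_ncard_of_injOn Subtype.val ?_ (Subtype.val_injective.injOn) ?_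
    · intro z hz
      exact ⟨z.2, hz⟩
    · exact W.finite_toSet.subset fun z hz => hz.1
  · intro v
    rw [hdeg]
    exact hΔ v v.2
  · rw [Fintype.card_coe]
    refine havg.trans (le_of_eq ?_)
    simp only [hdeg, SimpleGraph.dartCount]
    push_cast
    exact (Finset.sum_coe_sort W fun v => ((#{z ∈ W | G.Adj v z} : ℕ) : ℝ)).symm
  · rintro ⟨x, hx, hc⟩
    exact hno ⟨fun i => x i, hx, hc⟩

end

/-- The Turán bound for conflict-free cycles of length `2k`. -/
theorem SimpleGraph.exists_dartCount_le_of_not_hasConflictFreeCycle {k : ℕ} (hk : 0 < k) (s : ℕ) :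
    ∃ C : ℝ, 0 < C ∧ ∀ {V : Type} [DecidableEq V] (G : SimpleGraph V) [DecidableRel G.Adj]
      (conf : V → V → V → V → Prop) (_ : ∀ a b c d, conf a b c d → conf c d a b) (U : Finset V)
      (_ : ∀ u u' w, G.Adj u u' → {z | z ∈ U ∧ G.Adj w z ∧ conf u u' w z}.ncard ≤ s)
      (_ : ¬ G.HasConflictFreeCycle conf (2 * k)),
      (G.dartCount U U : ℝ) ≤ C * (#U : ℝ) ^ (1 + 1 / (k : ℝ)) := by
  -- With this choice `K ^ (1/k) = 36`, which is four times the bound `9` for `3 ^ a` used below.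
  obtain ⟨K, hK⟩ : ∃ K : ℕ, K = 36 ^ k := ⟨_, rfl⟩
  have hK0 : 0 < K := by rw [hK]; positivity
  have hKr : (0 : ℝ) < K := by exact_mod_cast hK0
  have hKpow : (K : ℝ) ^ (1 / (k : ℝ)) = 36 := by
    rw [hK]
    push_cast
    rw [one_div, Real.pow_rpow_inv_natCast (by norm_num) hk.ne']
  clear hK
  have hkr : (0 : ℝ) < k := by exact_mod_cast hk
  refine ⟨16 * k ^ 3 * s * K + K, by positivity, ?_⟩
  intro V _ G _ conf hsymm U₀ hs hno
  set a : ℝ := 1 + 1 / (k : ℝ) with ha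
  have hk1 : (1 : ℝ) ≤ k := by exact_mod_cast hk
  have ha1 : 1 ≤ a := by rw [ha]; linarith [show 0 < 1 / (k : ℝ) by positivity]
  have ha2 : a ≤ 2 := by
    rw [ha]; linarith [show 1 / (k : ℝ) ≤ 1 by rw [div_le_one hkr]; exact hk1]
  rcases U₀.eq_empty_or_nonempty with rfl | hU₀
  · simp only [SimpleGraph.dartCount, sum_empty, Nat.cast_zero]
    positivity
  -- Maximising the normalised density over all nonempty subsets means that no subset of `U₀` is
  -- denser than `U`, in the scale `|U| ^ a`. This forces few edges to meet the vertices of high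
  -- degree.
  obtain ⟨U, hU, hmax⟩ := Finset.exists_max_image ({U ∈ U₀.powerset | U.Nonempty})
    (fun U => (G.dartCount U U : ℝ) / (#U : ℝ) ^ a) ⟨U₀, by simp [hU₀]⟩
  simp only [mem_filter, mem_powerset] at hU hmax
  obtain ⟨hUU₀, hUne⟩ := hU
  set c : ℝ := (G.dartCount U U : ℝ) / (#U : ℝ) ^ a with hc
  set n : ℝ := (#U : ℝ) with hn
  have hn1 : 1 ≤ n := by rw [hn]; exact_mod_cast hUne.card_pos
  have hn0 : 0 < n := by linarith
  suffices hmain : c ≤ 16 * k ^ 3 * s * K + K by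
    have h := (hmax U₀ ⟨le_rfl, hU₀⟩).trans hmain
    rwa [div_le_iff₀ (Real.rpow_pos_of_pos (by exact_mod_cast hU₀.card_pos) _)] at h
  by_contra hcon
  rw [not_le] at hcon
  have hsk : (0 : ℝ) ≤ 16 * k ^ 3 * s * K := by positivity
  have hcK : (K : ℝ) < c := by linarith
  have hc0 : 0 < c := hKr.trans hcK
  have hna : 0 < n ^ a := Real.rpow_pos_of_pos hn0 _
  have hmax' : ∀ W : Finset V, W ⊆ U₀ → W.Nonempty → (G.dartCount W W : ℝ) ≤ c * (#W : ℝ) ^ a := by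
    intro W hW hWne
    have h := hmax W ⟨hW, hWne⟩
    rwa [div_le_iff₀ (Real.rpow_pos_of_pos (by exact_mod_cast hWne.card_pos) _)] at h
  set E : ℝ := (G.dartCount U U : ℝ) with hE
  have hEc : E = c * n ^ a := by rw [hc, div_mul_cancel₀ _ hna.ne']
  clear_value E c n a
  have hE0 : 0 < E := by rw [hEc]; positivity
  -- Together with `K < c` this gives `K < n`, so that `U` can be split into `K` nonempty parts.
  have hcn : c ≤ n := by
    have h1 : E ≤ n * n := by
      have := G.dartCount_le_sq U
      rw [hE, hn, ← sq]; exact_mod_cast this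
    have h2 : n ≤ n ^ a := Real.self_le_rpow_of_one_le hn1 ha1
    have h3 : c * n ≤ n * n := by
      rw [hEc] at h1
      exact (mul_le_mul_of_nonneg_left h2 hc0.le).trans h1
    exact le_of_mul_le_mul_right h3 hn0
  have hKn : (K : ℝ) < n := hcK.trans_le hcn
  set L : ℝ := K * E / n with hL
  clear_value L
  have hL0 : 0 < L := by rw [hL]; positivity
  set B : Finset V := {v ∈ U | L < #{z ∈ U | G.Adj v z}} with hB
  have hBU : B ⊆ U := filter_subset _ _
  have hBcard : (#B : ℝ) ≤ n / K := by
    have h1 : (#B : ℝ) * L ≤ E := by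
      have h2 : ∑ _v ∈ B, L ≤ ∑ v ∈ B, ((#{z ∈ U | G.Adj v z} : ℕ) : ℝ) :=
        Finset.sum_le_sum fun v hv => (mem_filter.1 hv).2.le
      rw [sum_const, nsmul_eq_mul] at h2
      refine h2.trans ?_
      rw [hE]
      exact_mod_cast Finset.sum_le_sum_of_subset (f := fun v => #{z ∈ U | G.Adj v z}) hBU
    rw [le_div_iff₀ hKr]
    rw [hL] at h1
    have h3 : (#B * K : ℝ) * E ≤ n * E := by
      have : (#B : ℝ) * (K * E / n) * n = #B * K * E := by
        rw [mul_assoc, div_mul_cancel₀ _ hn0.ne', mul_assoc]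
      nlinarith
    exact le_of_mul_le_mul_right h3 hE0
  -- Split `U` into `K` nearly equal parts `W`. Each `B ∪ W` has at most `3n/K` vertices, so by
  -- maximality the total is at most `K * c * (3n/K) ^ a`, which is at most `9/36` of `E`.
  have hBUcount : (G.dartCount B U : ℝ) ≤ E / 4 := by
    obtain ⟨P, hP, hPcard⟩ := Finpartition.exists_equipartition_card_eq U (n := K) hK0.ne'
      (by have : (K : ℝ) ≤ #U := by rw [← hn]; exact hKn.le
          exact_mod_cast this)
    have hpart : G.dartCount B U ≤ ∑ W ∈ P.parts, G.dartCount (B ∪ W) (B ∪ W) := by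
      have h1 : G.dartCount B U = ∑ W ∈ P.parts, G.dartCount B W := by
        rw [G.dartCount_comm, SimpleGraph.dartCount]
        have h2 := Finset.sum_biUnion (f := fun v => #{z ∈ B | G.Adj v z}) P.supIndep.pairwiseDisjoint
        rw [← Finset.sup_eq_biUnion] at h2
        rw [P.sup_parts] at h2
        rw [h2]
        exact Finset.sum_congr rfl fun W _ => G.dartCount_comm _ _
      rw [h1]
      exact Finset.sum_le_sum fun W _ => G.dartCount_mono subset_union_left subset_union_right
    have hterm : ∀ W ∈ P.parts, (G.dartCount (B ∪ W) (B ∪ W) : ℝ) ≤ c * (3 * n / K) ^ a := by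
      intro W hW
      have hWU : W ⊆ U := P.le hW
      have hWne : W.Nonempty := P.nonempty_of_mem_parts hW
      refine (hmax' (B ∪ W) ((union_subset hBU hWU).trans hUU₀) (hWne.mono subset_union_right)).trans ?_
      have h1 := hP.card_part_le_average_add_one hW
      rw [hPcard] at h1
      have h2 : (#W : ℝ) ≤ n / K + 1 := by
        have h3 : ((#U / K : ℕ) : ℝ) ≤ n / K := by
            rw [hn]; exact Nat.cast_div_le
        have h4 : (#W : ℝ) ≤ ((#U / K : ℕ) : ℝ) + 1 := by exact_mod_cast h1
        linarith
      have h5 : (1 : ℝ) ≤ n / K := by rw [le_div_iff₀ hKr]; linarith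
      have h6 : ((#(B ∪ W) : ℕ) : ℝ) ≤ #B + #W := by exact_mod_cast card_union_le _ _
      have h7 : ((#(B ∪ W) : ℕ) : ℝ) ≤ 3 * n / K := by
        have : 3 * n / K = 3 * (n / K) := by ring
        linarith
      exact mul_le_mul_of_nonneg_left
        (Real.rpow_le_rpow (Nat.cast_nonneg _) h7 (by linarith)) hc0.le
    have h8 : (G.dartCount B U : ℝ) ≤ K * (c * (3 * n / K) ^ a) := by
      have h9 : (G.dartCount B U : ℝ) ≤ ∑ W ∈ P.parts, (G.dartCount (B ∪ W) (B ∪ W) : ℝ) := by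
        exact_mod_cast hpart
      refine h9.trans ((Finset.sum_le_card_nsmul _ _ _ hterm).trans (le_of_eq ?_))
      rw [hPcard, nsmul_eq_mul]
    refine h8.trans ?_
    have hKa : (K : ℝ) ^ a = K * 36 := by
      rw [ha, Real.rpow_add hKr, Real.rpow_one, hKpow]
    have h3a : (3 : ℝ) ^ a ≤ 9 := by
      calc (3 : ℝ) ^ a ≤ 3 ^ (2 : ℝ) := Real.rpow_le_rpow_of_exponent_le (by norm_num) ha2
        _ = 9 := by norm_num
    rw [Real.div_rpow (by positivity) hKr.le, Real.mul_rpow (by norm_num) hn0.le, hKa, hEc]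
    have : (K : ℝ) * (c * (3 ^ a * n ^ a / (K * 36))) = 3 ^ a * (c * n ^ a / 36) := by
      field_simp
    rw [this]
    have h10 : 3 ^ a * (c * n ^ a / 36) ≤ 9 * (c * n ^ a / 36) := by gcongr
    linarith
  set W : Finset V := U \ B with hW
  have hWU : W ⊆ U := sdiff_subset
  have hWE : E / 2 ≤ G.dartCount W W := by
    have h1 := G.dartCount_sdiff_add hBU U
    have h2 := G.dartCount_sdiff_add hBU W
    have h3 : G.dartCount B W ≤ G.dartCount B U := G.dartCount_mono le_rfl hWU
    have h4 : G.dartCount W U = G.dartCount U W := G.dartCount_comm _ _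
    have h5 : G.dartCount U U ≤ G.dartCount W W + 2 * G.dartCount B U := by
      change G.dartCount W U + _ = _ at h1
      change G.dartCount W W + _ = _ at h2
      omega
    have h6 : E ≤ G.dartCount W W + 2 * G.dartCount B U := by
      rw [hE]; exact_mod_cast h5
    linarith
  have hWne : W.Nonempty := by
    rw [Finset.nonempty_iff_ne_empty]
    rintro h
    rw [h] at hWE
    simp only [SimpleGraph.dartCount, sum_empty, Nat.cast_zero] at hWE
    linarith
  have hWn : (#W : ℝ) ≤ n := by rw [hn]; exact_mod_cast card_le_card hWU
  have hcore := G.pow_le_dartCount_of_not_hasConflictFreeCycle hk hsymm (s := s) (Δ := ⌊L⌋₊) W hWne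
    (d := E / (2 * n)) ?_ ?_ (by positivity) ?_ hno
  · set y : ℝ := E / n with hy
    clear_value y
    -- The average degree `y / 2` and the degree bound `K * y` are comparable, so one factor `y ^ k`
    -- cancels in `hcore`; `y ^ k = c ^ k * n` then bounds `c`.
    have hy0 : 0 < y := by rw [hy]; positivity
    have hyk : y ^ k = c ^ k * n := by
      have : y = c * n ^ (1 / (k : ℝ)) := by
        rw [hy, hEc, ha, Real.rpow_add hn0, Real.rpow_one]; field_simp
      rw [this, mul_pow, one_div, Real.rpow_inv_natCast_pow hn0.le hk.ne']
    have h1 : (E / (2 * n)) ^ (2 * k) = y ^ k * y ^ k / 4 ^ k := by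
      have : E / (2 * n) = y / 2 := by rw [hy]; field_simp
      rw [this, pow_mul, div_pow, div_pow, ← mul_pow]
      norm_num
      ring
    have h2 : (4 * k ^ 3 * s * (⌊L⌋₊ : ℝ)) ^ k * #W ≤ (4 * k ^ 3 * s * (K * y)) ^ k * n := by
      have h3 : (⌊L⌋₊ : ℝ) ≤ K * y := (Nat.floor_le hL0.le).trans (le_of_eq (by rw [hL, hy]; ring))
      have h4 : (4 * k ^ 3 * s * (⌊L⌋₊ : ℝ)) ≤ 4 * k ^ 3 * s * (K * y) :=
        mul_le_mul_of_nonneg_left h3 (by positivity)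
      exact mul_le_mul (pow_le_pow_left₀ (by positivity) h4 _) hWn (Nat.cast_nonneg _) (by positivity)
    have h4 := hcore.trans h2
    rw [h1, div_le_iff₀ (by positivity)] at h4
    have h5 : (4 * k ^ 3 * s * (K * y)) ^ k * n * 4 ^ k = y ^ k * ((16 * k ^ 3 * s * K) ^ k * n) := by
      rw [show (4 * (k : ℝ) ^ 3 * s * (K * y)) = y * (4 * k ^ 3 * s * K) by ring, mul_pow,
        show (16 * (k : ℝ) ^ 3 * s * K) = (4 * k ^ 3 * s * K) * 4 by ring, mul_pow _ (4 : ℝ)]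
      ring
    rw [h5] at h4
    have h6 := le_of_mul_le_mul_left h4 (by positivity)
    rw [hyk] at h6
    have h7 := le_of_mul_le_mul_right h6 hn0
    have h8 := le_of_pow_le_pow_left₀ hk.ne' hsk h7
    linarith
  · intro u u' w h
    refine (Set.ncard_le_ncard ?_ ?_).trans (hs u u' w h)
    · rintro z ⟨h1, h2⟩
      exact ⟨hUU₀ (hWU h1), h2⟩
    · exact U₀.finite_toSet.subset fun z hz => hz.1
  · intro v hv
    rw [hW, mem_sdiff, hB, mem_filter, not_and, not_lt] at hv
    refine Nat.le_floor (le_trans ?_ (hv.2 hv.1))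
    exact_mod_cast card_le_card (filter_subset_filter _ hWU)
  · refine le_trans ?_ hWE
    calc E / (2 * n) * #W ≤ E / (2 * n) * n := by gcongr
      _ = E / 2 := by field_simp

end Turan

/-! ### Large independent sets in triangle-free graphs. -/

section TriangleFree

variable {V : Type*} [DecidableEq V]

/-- The trade-off behind the random independent set argument: either few neighbours survive, and
the vertex itself is likely to be chosen, or many do. -/
theorem Real.log_div_eight_le_expected {D : ℝ} (hD : 1 ≤ D) (x : ℕ) :
    Real.log D / 8 * (2 ^ x + 1) ≤ D + x * 2 ^ x / 2 := by
  have hD0 : 0 < D := by linarith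
  have hlog0 : 0 ≤ Real.log D := Real.log_nonneg hD
  have hsq : √D * √D = D := Real.mul_self_sqrt hD0.le
  have hs1 : 1 ≤ √D := by rw [Real.one_le_sqrt]; exact hD
  have hlogs : Real.log D = 2 * Real.log √D := by rw [Real.log_sqrt hD0.le]; ring
  have hp : (1 : ℝ) ≤ 2 ^ x := one_le_pow₀ (by norm_num)
  rcases le_total ((2 : ℝ) ^ x) √D with h | h
  · have h1 : Real.log √D ≤ √D := (Real.log_le_sub_one_of_pos (by linarith)).trans (by linarith)
    have h2 : Real.log D / 8 * (2 ^ x + 1) ≤ (2 * √D) / 8 * (√D + √D) := by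
      rw [hlogs]; gcongr
    have h3 : (0 : ℝ) ≤ x * 2 ^ x / 2 := by positivity
    nlinarith
  · have h1 : Real.log √D ≤ x := by
      have h2 : Real.log √D ≤ Real.log (2 ^ x) := Real.log_le_log (by linarith) h
      rw [Real.log_pow] at h2
      have h3 : Real.log 2 ≤ 1 := by
        have := Real.log_two_lt_d9; linarith
      have : (x : ℝ) * Real.log 2 ≤ x * 1 := by gcongr
      linarith
    have h4 : Real.log D / 8 * (2 ^ x + 1) ≤ (2 * x) / 8 * (2 ^ x + 2 ^ x) := by
      rw [hlogs]; gcongr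
    nlinarith

/-- A triangle-free graph on `U` with maximum degree at most `D` has an independent set with
at least `|U| log D / (16 D)` vertices. -/
theorem SimpleGraph.exists_isIndepSet_of_triangleFree (G : SimpleGraph V) [DecidableRel G.Adj]
    (U : Finset V) {D : ℝ} (hD : 1 ≤ D) (hdeg : ∀ v ∈ U, (#{z ∈ U | G.Adj v z} : ℝ) ≤ D)
    (htri : ∀ u ∈ U, ∀ v ∈ U, ∀ w ∈ U, G.Adj u v → G.Adj v w → ¬ G.Adj u w) :
    ∃ W ⊆ U, (∀ u ∈ W, ∀ v ∈ W, ¬ G.Adj u v) ∧ #U * Real.log D / (16 * D) ≤ (#W : ℝ) := by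
  classical
  have hD0 : 0 < D := by linarith
  -- A uniformly random independent set `W` is averaged over. The weight `X v W` rewards both
  -- choosing `v` and choosing its neighbours; its sum over `v` is at most `2 * D * |W|`, so a lower
  -- bound on its mean for each `v` suffices.
  let I : Finset (Finset V) := {W ∈ U.powerset | ∀ u ∈ W, ∀ v ∈ W, ¬ G.Adj u v}
  have hI : ∀ W, W ∈ I ↔ W ⊆ U ∧ ∀ u ∈ W, ∀ v ∈ W, ¬ G.Adj u v := by
    intro W; simp [I]
  have hIne : (∅ : Finset V) ∈ I := by simp [hI]
  let nb : V → Finset V := fun v => {z ∈ U | G.Adj v z}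
  let X : V → Finset V → ℝ := fun v W => (if v ∈ W then D else 0) + #(W ∩ nb v)
  have hXsum : ∀ W ∈ I, ∑ v ∈ U, X v W ≤ 2 * D * #W := by
    intro W hW
    obtain ⟨hWU, -⟩ := (hI W).1 hW
    simp only [X]
    rw [Finset.sum_add_distrib]
    have h1 : ∑ v ∈ U, (if v ∈ W then D else 0) = D * #W := by
      rw [← Finset.sum_filter, sum_const, nsmul_eq_mul, Finset.filter_mem_eq_inter,
        Finset.inter_eq_right.2 hWU, mul_comm]
    have h2 : ∑ v ∈ U, #(W ∩ nb v) = ∑ w ∈ W, #(nb w) := by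
      have := G.dartCount_comm U W
      simp only [SimpleGraph.dartCount] at this
      rw [← this]
      refine Finset.sum_congr rfl fun v _ => ?_
      congr 1
      ext z
      simp only [nb, mem_inter, mem_filter]
      constructor
      · rintro ⟨a, _, b⟩; exact ⟨a, b⟩
      · rintro ⟨a, b⟩; exact ⟨a, hWU a, b⟩
    have h3 : ∑ v ∈ U, (#(W ∩ nb v) : ℝ) ≤ D * #W := by
      have : (∑ v ∈ U, (#(W ∩ nb v) : ℝ)) = ∑ w ∈ W, (#(nb w) : ℝ) := by exact_mod_cast h2
      rw [this]
      refine (Finset.sum_le_sum fun w hw => hdeg w (hWU hw)).trans ?_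
      rw [sum_const, nsmul_eq_mul, mul_comm]
    linarith
  have hfib : ∀ v ∈ U, Real.log D / 8 * #I ≤ ∑ W ∈ I, X v W := by
    intro v hv
    -- Condition on the part of `W` outside the closed neighbourhood of `v`.
    let π : Finset V → Finset V := fun W => W \ insert v (nb v)
    have hmaps : ∀ W ∈ I, π W ∈ I.image π := fun W hW => mem_image_of_mem _ hW
    rw [← Finset.sum_fiberwise_of_maps_to hmaps, Finset.card_eq_sum_card_fiberwise hmaps]
    push_cast
    rw [Finset.mul_sum]
    refine Finset.sum_le_sum fun S hS => ?_
    obtain ⟨W₀, hW₀, hW₀S⟩ := mem_image.1 hS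
    obtain ⟨hW₀U, hW₀i⟩ := (hI W₀).1 hW₀
    have hSU : S ⊆ U := by rw [← hW₀S]; exact sdiff_subset.trans hW₀U
    have hSW₀ : S ⊆ W₀ := by rw [← hW₀S]; exact sdiff_subset
    have hSd : ∀ y ∈ S, y ≠ v ∧ ¬ G.Adj v y := by
      intro y hy
      have hyU := hSU hy
      rw [← hW₀S] at hy
      simp only [π, nb, mem_sdiff, mem_insert, mem_filter, not_or, not_and] at hy
      exact ⟨hy.2.1, hy.2.2 hyU⟩
    -- The neighbours of `v` still available given `S`. The fibre over `S` consists of `S ∪ {v}` and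
    -- of `S ∪ T` for arbitrary `T ⊆ N`, that is, `2 ^ |N| + 1` sets.
    let N : Finset V := {z ∈ nb v | ∀ y ∈ S, ¬ G.Adj y z}
    have hvnb : v ∉ nb v := by simp [nb]
    have hvS : v ∉ S := fun h => (hSd v h).1 rfl
    have hdisj : ∀ T ⊆ N, Disjoint S T := by
      intro T hT
      rw [Finset.disjoint_left]
      intro y hy hyT
      have := hT hyT
      simp only [N, nb, mem_filter] at this
      exact (hSd y hy).2 this.1.2
    have hfiber : ({W ∈ I | π W = S} : Finset (Finset V)) =
        insert (insert v S) (N.powerset.image fun T => S ∪ T) := by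
      ext W
      simp only [mem_filter, mem_insert, mem_image, mem_powerset, hI]
      constructor
      · rintro ⟨⟨hWU, hWi⟩, hWS⟩
        by_cases hvW : v ∈ W
        · left
          ext y
          rw [← hWS]
          simp only [π, nb, mem_insert, mem_sdiff, mem_filter, not_or, not_and]
          constructor
          · intro hy
            by_cases hyv : y = v
            · exact Or.inl hyv
            · exact Or.inr ⟨hy, hyv, fun _ => hWi v hvW y hy⟩
          · rintro (rfl | h)
            · exact hvW
            · exact h.1
        · right
          refine ⟨W ∩ nb v, ?_, ?_⟩
          · intro z hz
            rw [mem_inter] at hz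
            simp only [N, mem_filter]
            refine ⟨hz.2, fun y hy => ?_⟩
            rw [← hWS] at hy
            exact hWi y (sdiff_subset hy) z hz.1
          · rw [← hWS]
            ext y
            simp only [π, mem_union, mem_sdiff, mem_insert, mem_inter, not_or]
            constructor
            · rintro (h | h)
              · exact h.1
              · exact h.1
            · intro hy
              by_cases hn : y ∈ nb v
              · exact Or.inr ⟨hy, hn⟩
              · exact Or.inl ⟨hy, fun h => hvW (h ▸ hy), hn⟩
      · rintro (rfl | ⟨T, hT, rfl⟩)
        · refine ⟨⟨Finset.insert_subset hv hSU, ?_⟩, ?_⟩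
          · intro a ha b hb
            rw [mem_insert] at ha hb
            rcases ha with rfl | ha <;> rcases hb with rfl | hb
            · exact G.irrefl
            · exact (hSd b hb).2
            · exact fun h => (hSd a ha).2 h.symm
            · exact hW₀i a (hSW₀ ha) b (hSW₀ hb)
          · ext y
            simp only [π, nb, mem_sdiff, mem_insert, mem_filter, not_or, not_and]
            constructor
            · rintro ⟨h1 | h1, h2⟩
              · exact absurd h1 h2.1
              · exact h1
            · intro hy
              exact ⟨Or.inr hy, (hSd y hy).1, fun _ => (hSd y hy).2⟩
        · have hTnb : ∀ z ∈ T, z ∈ U ∧ G.Adj v z ∧ ∀ y ∈ S, ¬ G.Adj y z := by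
            intro z hz
            have := hT hz
            simp only [N, nb, mem_filter] at this
            exact ⟨this.1.1, this.1.2, this.2⟩
          refine ⟨⟨Finset.union_subset hSU fun z hz => (hTnb z hz).1, ?_⟩, ?_⟩
          · intro a ha b hb
            rw [mem_union] at ha hb
            rcases ha with ha | ha <;> rcases hb with hb | hb
            · exact hW₀i a (hSW₀ ha) b (hSW₀ hb)
            · exact (hTnb b hb).2.2 a ha
            · exact fun h => (hTnb a ha).2.2 b hb h.symm
            -- Triangle-freeness enters here: the neighbours of `v` are pairwise nonadjacent, so `T`
            -- is unrestricted.
            · exact fun h => htri v hv a (hTnb a ha).1 b (hTnb b hb).1 (hTnb a ha).2.1 h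
                (hTnb b hb).2.1
          · ext y
            simp only [π, nb, mem_sdiff, mem_insert, mem_filter, not_or, not_and, mem_union]
            constructor
            · rintro ⟨h1 | h1, h2⟩
              · exact h1
              · exact absurd (hTnb y h1).2.1 (h2.2 (hTnb y h1).1)
            · intro hy
              exact ⟨Or.inl hy, (hSd y hy).1, fun _ => (hSd y hy).2⟩
    have hvN : v ∉ N := fun h => hvnb (filter_subset _ _ h)
    have hnotmem : insert v S ∉ N.powerset.image fun T => S ∪ T := by
      rw [mem_image]
      rintro ⟨T, hT, h⟩
      have : v ∈ S ∪ T := by rw [h]; exact mem_insert_self _ _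
      rcases mem_union.1 this with h1 | h1
      · exact hvS h1
      · exact hvN (mem_powerset.1 hT h1)
    have hinj : Set.InjOn (fun T => S ∪ T) (N.powerset : Set (Finset V)) := by
      intro T hT T' hT' h
      have h1 := hdisj T (mem_powerset.1 hT)
      have h2 := hdisj T' (mem_powerset.1 hT')
      have h3 : (S ∪ T) \ S = (S ∪ T') \ S := by simp only at h; rw [h]
      rwa [Finset.union_sdiff_cancel_left h1, Finset.union_sdiff_cancel_left h2] at h3
    rw [hfiber, card_insert_of_notMem hnotmem, card_image_of_injOn hinj, card_powerset,
      sum_insert hnotmem, sum_image hinj]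
    have hX1 : D ≤ X v (insert v S) := by
      simp only [X, mem_insert_self, if_true]
      linarith [Nat.cast_nonneg (α := ℝ) #(insert v S ∩ nb v)]
    have hX2 : ∀ T ∈ N.powerset, (#T : ℝ) ≤ X v (S ∪ T) := by
      intro T hT
      rw [mem_powerset] at hT
      have h1 : #T ≤ #((S ∪ T) ∩ nb v) := by
        refine card_le_card fun z hz => mem_inter.2 ⟨mem_union_right _ hz, ?_⟩
        exact filter_subset _ _ (hT hz)
      have h2 : (#T : ℝ) ≤ #((S ∪ T) ∩ nb v) := by exact_mod_cast h1
      simp only [X]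
      split_ifs <;> linarith
    have hX3 : ∑ T ∈ N.powerset, (#T : ℝ) = #N * 2 ^ #N / 2 := by
      have h1 : ∑ T ∈ N.powerset, #T = #N * 2 ^ (#N - 1) := by
        rw [Finset.sum_powerset_apply_card (fun i => i), ← Nat.sum_range_mul_choose]
        exact Finset.sum_congr rfl fun i _ => by rw [smul_eq_mul, mul_comm]
      have h2 : ∑ T ∈ N.powerset, (#T : ℝ) = #N * 2 ^ (#N - 1) := by exact_mod_cast h1
      rw [h2]
      rcases Nat.eq_zero_or_pos #N with h | h
      · simp [h]
      · obtain ⟨m, hm⟩ : ∃ m, #N = m + 1 := ⟨#N - 1, by omega⟩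
        rw [hm, Nat.add_sub_cancel, pow_succ]
        ring
    have hX4 := Finset.sum_le_sum hX2
    rw [hX3] at hX4
    have := Real.log_div_eight_le_expected hD #N
    push_cast
    linarith
  by_contra hcon
  push Not at hcon
  have h1 : ∑ W ∈ I, ∑ v ∈ U, X v W < ∑ _W ∈ I, (#U * Real.log D / 8) := by
    refine Finset.sum_lt_sum_of_nonempty ⟨_, hIne⟩ fun W hW => ?_
    obtain ⟨hWU, hWi⟩ := (hI W).1 hW
    have h2 := hcon W hWU hWi
    rw [lt_div_iff₀ (by positivity)] at h2
    linarith [hXsum W hW]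
  rw [Finset.sum_comm] at h1
  have h3 := Finset.sum_le_sum hfib
  rw [sum_const, nsmul_eq_mul] at h3 h1
  nlinarith

end TriangleFree

/-! ### Random sampling with deletion. -/

section Sampling

variable {V : Type*} [Fintype V] [DecidableEq V]

/-- Counting form of independence: in the zero set of a uniform random function to `Fin (q + 1)`, a
set `t` survives with probability `(q + 1) ^ (-|t|)`. -/
theorem Finset.card_pi_eq_zero_mul_pow (q : ℕ) (t : Finset V) :
    #{f : V → Fin (q + 1) | ∀ v ∈ t, f v = 0} * (q + 1) ^ #t = (q + 1) ^ Fintype.card V := by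
  have h : ({f : V → Fin (q + 1) | ∀ v ∈ t, f v = 0} : Finset _) =
      Fintype.piFinset fun v => if v ∈ t then {0} else univ := by
    ext f
    simp only [mem_filter, mem_univ, true_and, Fintype.mem_piFinset]
    refine forall_congr' fun v => ?_
    by_cases hv : v ∈ t <;> simp [hv]
  rw [h, Fintype.card_piFinset]
  have h2 : ∀ v, #(if v ∈ t then ({0} : Finset (Fin (q + 1))) else univ) =
      if v ∈ t then 1 else (q + 1) := by
    intro v; split_ifs <;> simp
  simp only [h2]
  rw [Finset.prod_ite, prod_const_one, one_mul, prod_const, ← pow_add]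
  congr 1
  rw [Finset.filter_not, Finset.filter_mem_eq_inter, univ_inter, ← Finset.card_univ]
  exact Finset.card_sdiff_add_card_eq_card (subset_univ _)

/-- The deletion method: from a random set of density `1 / q`, one vertex of each set in `T`
is deleted. -/
theorem SimpleGraph.exists_sparse_subset (G : SimpleGraph V) [DecidableRel G.Adj] (U : Finset V)
    (T : Finset (Finset V)) (hT : ∀ t ∈ T, 3 ≤ #t) {q : ℕ} (hq : 0 < q) {c X : ℝ} (hc : 0 ≤ c)
    (hX : 0 ≤ X)
    (h : X ≤ #U / q - #T / q ^ 3 - c * G.dartCount U U / q ^ 2) :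
    ∃ S ⊆ U, (∀ t ∈ T, ¬ t ⊆ S) ∧ X ≤ #S ∧ c * G.dartCount S S ≤ #S := by
  obtain ⟨p, rfl⟩ : ∃ p, q = p + 1 := ⟨q - 1, by omega⟩
  set Q : ℝ := ((p + 1 : ℕ) : ℝ) with hQ
  have hQ0 : 0 < Q := by rw [hQ]; positivity
  have hQ1 : 1 ≤ Q := by rw [hQ]; push_cast; linarith [Nat.cast_nonneg (α := ℝ) p]
  set n := Fintype.card V with hn
  have hcount : ∀ t : Finset V, (#{f : V → Fin (p + 1) | ∀ v ∈ t, f v = 0} : ℝ) = Q ^ n / Q ^ #t := by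
    intro t
    rw [eq_div_iff (by positivity)]
    rw [hQ, hn]
    exact_mod_cast Finset.card_pi_eq_zero_mul_pow p t
  let S : (V → Fin (p + 1)) → Finset V := fun f => {v ∈ U | f v = 0}
  have hSU : ∀ f, S f ⊆ U := fun f => filter_subset _ _
  have h1 : ∑ f, (#(S f) : ℝ) = Q ^ n * (#U / Q) := by
    have : ∑ f, (#(S f) : ℝ) = ∑ v ∈ U, (#{f : V → Fin (p + 1) | f v = 0} : ℝ) := by
      exact_mod_cast Finset.sum_card_bipartiteAbove_eq_sum_card_bipartiteBelow
        (s := univ) (t := U) (fun (f : V → Fin (p + 1)) v => f v = 0)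
    rw [this]
    have h2 : ∀ v ∈ U, (#{f : V → Fin (p + 1) | f v = 0} : ℝ) = Q ^ n / Q := by
      intro v _
      simpa using hcount {v}
    rw [Finset.sum_congr rfl h2, sum_const, nsmul_eq_mul]
    ring
  have h2 : ∑ f, (#{t ∈ T | t ⊆ S f} : ℝ) ≤ Q ^ n * (#T / Q ^ 3) := by
    have : ∑ f, (#{t ∈ T | t ⊆ S f} : ℝ) = ∑ t ∈ T, (#{f | t ⊆ S f} : ℝ) := by
      exact_mod_cast Finset.sum_card_bipartiteAbove_eq_sum_card_bipartiteBelow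
        (s := univ) (t := T) (fun (f : V → Fin (p + 1)) t => t ⊆ S f)
    rw [this]
    have h3 : ∀ t ∈ T, (#{f | t ⊆ S f} : ℝ) ≤ Q ^ n / Q ^ 3 := by
      intro t ht
      have h4 : (#{f | t ⊆ S f} : ℝ) ≤ #{f : V → Fin (p + 1) | ∀ v ∈ t, f v = 0} := by
        norm_cast
        refine card_le_card fun f hf => ?_
        simp only [mem_filter, mem_univ, true_and] at hf ⊢
        intro v hv
        exact (mem_filter.1 (hf hv)).2
      refine h4.trans ?_
      rw [hcount]
      have := hT t ht
      gcongr
    refine (Finset.sum_le_sum h3).trans (le_of_eq ?_)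
    rw [sum_const, nsmul_eq_mul]
    ring
  have h3 : ∑ f, (G.dartCount (S f) (S f) : ℝ) ≤ Q ^ n * (G.dartCount U U / Q ^ 2) := by
    have h4 : ∀ f, (G.dartCount (S f) (S f) : ℝ) =
        ∑ u ∈ U, ∑ v ∈ U with G.Adj u v, if f u = 0 ∧ f v = 0 then 1 else 0 := by
      intro f
      simp only [SimpleGraph.dartCount, S]
      push_cast
      rw [Finset.sum_filter]
      refine Finset.sum_congr rfl fun u _ => ?_
      by_cases hu : f u = 0
      · simp only [hu, if_true, true_and]
        rw [← Finset.sum_filter, sum_const, nsmul_eq_mul, mul_one, Finset.filter_filter,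
          Finset.filter_filter]
        simp only [and_comm]
      · simp [hu]
    rw [Finset.sum_congr rfl fun f _ => h4 f, Finset.sum_comm]
    have h5 : ∀ u ∈ U, ∑ f : V → Fin (p + 1), ∑ v ∈ U with G.Adj u v,
        (if f u = 0 ∧ f v = 0 then (1 : ℝ) else 0) = #{v ∈ U | G.Adj u v} * (Q ^ n / Q ^ 2) := by
      intro u _
      rw [Finset.sum_comm]
      have h6 : ∀ v ∈ ({v ∈ U | G.Adj u v} : Finset V), ∑ f : V → Fin (p + 1),
          (if f u = 0 ∧ f v = 0 then (1 : ℝ) else 0) = Q ^ n / Q ^ 2 := by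
        intro v hv
        have hne : u ≠ v := (mem_filter.1 hv).2.ne
        have := hcount {u, v}
        rw [card_pair hne] at this
        rw [← this, ← Finset.sum_filter, sum_const, nsmul_eq_mul, mul_one]
        congr 2
        ext f
        simp
      rw [Finset.sum_congr rfl h6, sum_const, nsmul_eq_mul]
    rw [Finset.sum_congr rfl h5, ← Finset.sum_mul, SimpleGraph.dartCount]
    push_cast
    exact le_of_eq (by ring)
  have hcardf : (Fintype.card (V → Fin (p + 1)) : ℝ) = Q ^ n := by
    rw [Fintype.card_fun, Fintype.card_fin, hQ]; push_cast; rfl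
  -- Some sample does at least as well as the mean. As both subtracted terms are nonnegative, this
  -- single inequality yields both the size bound and the edge bound.
  obtain ⟨f, -, hf⟩ : ∃ f ∈ (univ : Finset (V → Fin (p + 1))),
      X ≤ #(S f) - #{t ∈ T | t ⊆ S f} - c * G.dartCount (S f) (S f) := by
    refine Finset.exists_le_of_sum_le (univ_nonempty) ?_
    rw [sum_const, nsmul_eq_mul, Finset.card_univ, hcardf, Finset.sum_sub_distrib,
      Finset.sum_sub_distrib, ← Finset.mul_sum, h1]
    have h4 : Q ^ n * X ≤ Q ^ n * (#U / Q - #T / Q ^ 3 - c * G.dartCount U U / Q ^ 2) := by gcongr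
    have h5 := mul_le_mul_of_nonneg_left h3 hc
    have h6 : Q ^ n * (#U / Q - #T / Q ^ 3 - c * G.dartCount U U / Q ^ 2) =
      Q ^ n * (#U / Q) - Q ^ n * (#T / Q ^ 3) - c * (Q ^ n * (G.dartCount U U / Q ^ 2)) := by ring
    linarith
  -- The vertex to delete from `t`, as a set of size at most one; the empty set is a default outside
  -- `T`.
  have hne : ∀ t : Finset V, ∃ s : Finset V, #s ≤ 1 ∧ (t ∈ T → ∃ v ∈ s, v ∈ t) := by
    intro t
    by_cases ht : t ∈ T
    · obtain ⟨v, hv⟩ : t.Nonempty := card_pos.1 (by have := hT t ht; omega)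
      exact ⟨{v}, by simp, fun _ => ⟨v, by simp, hv⟩⟩
    · exact ⟨∅, by simp, fun h => absurd h ht⟩
  choose g hg1 hg using hne
  set Y := ({t ∈ T | t ⊆ S f} : Finset _) with hY
  refine ⟨S f \ Y.biUnion g, sdiff_subset.trans (hSU f), ?_, ?_⟩
  · intro t ht hts
    obtain ⟨v, hv, hvt⟩ := hg t ht
    exact (mem_sdiff.1 (hts hvt)).2
      (mem_biUnion.2 ⟨t, mem_filter.2 ⟨ht, hts.trans sdiff_subset⟩, hv⟩)
  · have h4 : #(S f) ≤ #(S f \ Y.biUnion g) + #Y := by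
      have h5 := Finset.le_card_sdiff (Y.biUnion g) (S f)
      have h6 : #(Y.biUnion g) ≤ #Y := by
        simpa using card_biUnion_le_card_mul Y g 1 fun t _ => hg1 t
      omega
    have h5 : (#(S f) : ℝ) ≤ #(S f \ Y.biUnion g) + #Y := by exact_mod_cast h4
    have h6 : c * G.dartCount (S f \ Y.biUnion g) (S f \ Y.biUnion g) ≤ c * G.dartCount (S f) (S f) := by
      gcongr
      exact G.dartCount_mono sdiff_subset sdiff_subset
    have h7 : 0 ≤ c * G.dartCount (S f) (S f) := by positivity
    constructor <;> linarith

/-- At least half of the vertices have at most twice the average degree. -/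
theorem SimpleGraph.exists_subset_degree_le {V : Type*} [DecidableEq V] (G : SimpleGraph V)
    [DecidableRel G.Adj] (U : Finset V)
    {D : ℝ} (hD : 0 < D) (h : G.dartCount U U ≤ D * #U) :
    ∃ W ⊆ U, (#U : ℝ) / 2 ≤ #W ∧ ∀ v ∈ W, (#{z ∈ U | G.Adj v z} : ℝ) ≤ 2 * D := by
  refine ⟨{v ∈ U | (#{z ∈ U | G.Adj v z} : ℝ) ≤ 2 * D}, filter_subset _ _, ?_, fun v hv => (mem_filter.1 hv).2⟩
  set B := ({v ∈ U | ¬ (#{z ∈ U | G.Adj v z} : ℝ) ≤ 2 * D} : Finset V) with hB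
  have h1 : (#B : ℝ) * (2 * D) ≤ D * #U := by
    refine le_trans ?_ h
    have h2 : ∑ _v ∈ B, 2 * D ≤ ∑ v ∈ B, ((#{z ∈ U | G.Adj v z} : ℕ) : ℝ) :=
      Finset.sum_le_sum fun v hv => (not_le.1 (mem_filter.1 hv).2).le
    rw [sum_const, nsmul_eq_mul] at h2
    refine h2.trans ?_
    exact_mod_cast Finset.sum_le_sum_of_subset (f := fun v => #{z ∈ U | G.Adj v z})
      (filter_subset _ U)
  have h3 := Finset.card_filter_add_card_filter_not (s := U) (fun v => (#{z ∈ U | G.Adj v z} : ℝ) ≤ 2 * D)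
  have h4 : (#{v ∈ U | (#{z ∈ U | G.Adj v z} : ℝ) ≤ 2 * D} : ℝ) + #B = #U := by
    exact_mod_cast h3
  have h5 : D * (2 * #B) ≤ D * #U := by linarith
  have h6 := le_of_mul_le_mul_left h5 hD
  linarith

end Sampling

/-! ### Sunflower kernels and linear cycles. -/

section Kernels

variable {V : Type} [DecidableEq V]

/-- The sets obtained from the members of a family `R` by repeatedly passing to the kernel, of size
at least two, of a sunflower with `q` petals. -/
inductive IsSunflowerKernel (R : Finset V → Prop) (q : ℕ) : Finset V → Prop
  | of_mem (S : Finset V) (hS : R S) : IsSunflowerKernel R q S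
  | of_sunflower (S : Finset V) (f : Fin q → Finset V) (hS : 2 ≤ #S) (hf : ∀ a, S ⊂ f a)
      (hd : ∀ a b, a ≠ b → Disjoint (f a \ S) (f b \ S))
      (hk : ∀ a, IsSunflowerKernel R q (f a)) : IsSunflowerKernel R q S

/-- A family of sets contains a linear cycle of length `ℓ`: the set `e i` contains the vertices
`x i` and `x (i + 1)`, and the sets `e i \ {x i}` are disjoint. -/
def HasLinearCycle (R : Finset V → Prop) (ℓ : ℕ) : Prop :=
  ∃ (x : ZMod ℓ → V) (e : ZMod ℓ → Finset V), (∀ i, R (e i)) ∧ (∀ i, x i ∈ e i) ∧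
    (∀ i, x (i + 1) ∈ e i) ∧ (∀ i, x i ≠ x (i + 1)) ∧
    ∀ i j, i ≠ j → Disjoint (e i \ {x i}) (e j \ {x j})

variable {R : Finset V → Prop} {q r : ℕ}

/-- Among `q` disjoint petals one avoids `X`, as `X` has fewer than `q` points. Descending through
the nested sunflowers in this way reaches a member of `R`. -/
theorem IsSunflowerKernel.exists_superset {S : Finset V} (h : IsSunflowerKernel R q S)
    (X : Finset V) (hX : #X < q) : ∃ e, R e ∧ S ⊆ e ∧ e ∩ X ⊆ S := by
  induction h with
  | of_mem S hS => exact ⟨S, hS, Subset.rfl, inter_subset_left⟩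
  | of_sunflower S f hS hf hd hk ih =>
    obtain ⟨a, ha⟩ : ∃ a, Disjoint (f a \ S) X := by
      by_contra hcon
      push Not at hcon
      have h1 : ∀ a, ∃ y, y ∈ f a \ S ∧ y ∈ X := fun a => Finset.not_disjoint_iff.1 (hcon a)
      choose y hy hyX using h1
      have h2 := Finset.card_le_card_of_injOn (s := univ) (t := X) y (fun a _ => hyX a) (by
        intro a _ b _ hab
        by_contra hne
        exact Finset.disjoint_left.1 (hd a b hne) (hy a) (hab ▸ hy b))
      simp at h2
      omega
    obtain ⟨e, he, hse, hex⟩ := ih a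
    refine ⟨e, he, (hf a).1.trans hse, fun z hz => ?_⟩
    by_contra hzS
    exact Finset.disjoint_left.1 ha (mem_sdiff.2 ⟨hex hz, hzS⟩) (mem_inter.1 hz).2

theorem IsSunflowerKernel.two_le_card {S : Finset V} (h : IsSunflowerKernel R q S)
    (hR : ∀ e, R e → #e = r) (hr : 2 ≤ r) : 2 ≤ #S := by
  induction h with
  | of_mem S hS => rw [hR S hS]; exact hr
  | of_sunflower S f hS hf hd hk ih => exact hS

theorem IsSunflowerKernel.card_le {S : Finset V} (h : IsSunflowerKernel R q S)
    (hR : ∀ e, R e → #e = r) (hq : 0 < q) : #S ≤ r := by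
  obtain ⟨e, he, hS, -⟩ := h.exists_superset ∅ (by simpa using hq)
  rw [← hR e he]
  exact card_le_card hS

/-- A linear cycle of sunflower kernels expands to a linear cycle in the family itself. -/
theorem HasLinearCycle.of_isSunflowerKernel {ℓ : ℕ} [NeZero ℓ] (hR : ∀ e, R e → #e = r)
    (hq : ℓ * r < q) (h : HasLinearCycle (IsSunflowerKernel R q) ℓ) : HasLinearCycle R ℓ := by
  obtain ⟨x, e, hk, hx, hx', hne, hd⟩ := h
  -- Kernels are replaced by members of `R` one at a time. The new set meets the union of the
  -- current ones, of size at most `ℓ * r < q`, only inside the kernel it replaces, so disjointness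
  -- is preserved.
  have key : ∀ I : Finset (ZMod ℓ), ∃ e : ZMod ℓ → Finset V, (∀ i, IsSunflowerKernel R q (e i)) ∧
      (∀ i ∈ I, R (e i)) ∧ (∀ i, x i ∈ e i) ∧ (∀ i, x (i + 1) ∈ e i) ∧
      ∀ i j, i ≠ j → Disjoint (e i \ {x i}) (e j \ {x j}) := by
    intro I
    induction I using Finset.induction_on with
    | empty => exact ⟨e, hk, by simp, hx, hx', hd⟩
    | insert j I hj ih =>
      obtain ⟨e, hk, hI, hx, hx', hd⟩ := ih
      let X : Finset V := univ.biUnion e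
      have hX : #X < q := by
        refine lt_of_le_of_lt (card_biUnion_le_card_mul _ _ r fun i _ =>
          (hk i).card_le hR (by omega)) ?_
        rwa [Finset.card_univ, ZMod.card]
      obtain ⟨e', he', hsub, hX'⟩ := (hk j).exists_superset X hX
      have hdj : ∀ i, i ≠ j → Disjoint (e i \ {x i}) (e' \ {x j}) := by
        intro i hij
        rw [Finset.disjoint_left]
        intro y hy hy'
        rw [mem_sdiff] at hy'
        have h1 : y ∈ e j := hX' (mem_inter.2 ⟨hy'.1, mem_biUnion.2 ⟨i, mem_univ _, sdiff_subset hy⟩⟩)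
        exact Finset.disjoint_left.1 (hd i j hij) hy (mem_sdiff.2 ⟨h1, hy'.2⟩)
      refine ⟨Function.update e j e', ?_, ?_, ?_, ?_, ?_⟩
      · intro i
        by_cases h : i = j
        · subst h; simpa using IsSunflowerKernel.of_mem _ he'
        · simpa [h] using hk i
      · intro i hi
        by_cases h : i = j
        · subst h; simpa using he'
        · simpa [h] using hI i (mem_of_mem_insert_of_ne hi h)
      · intro i
        by_cases h : i = j
        · subst h; simpa using hsub (hx i)
        · simpa [h] using hx i
      · intro i
        by_cases h : i = j
        · subst h; simpa using hsub (hx' i)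
        · simpa [h] using hx' i
      · intro a b hab
        by_cases ha : a = j
        · subst ha
          simpa [hab.symm] using (hdj b hab.symm).symm
        · by_cases hb : b = j
          · subst hb
            simpa [ha] using hdj a ha
          · simpa [ha, hb] using hd a b hab
  obtain ⟨e, -, hI, h1, h2, h3⟩ := key univ
  exact ⟨x, e, fun i => hI i (mem_univ i), h1, h2, hne, h3⟩

/-- The minimal sunflower kernels. -/
noncomputable def minimalKernels [Fintype V] (R : Finset V → Prop) (q : ℕ) : Finset (Finset V) :=
  open Classical in {S | IsSunflowerKernel R q S ∧ ∀ T ⊂ S, ¬ IsSunflowerKernel R q T}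

variable [Fintype V]

theorem mem_minimalKernels {S : Finset V} : S ∈ minimalKernels R q ↔
    IsSunflowerKernel R q S ∧ ∀ T ⊂ S, ¬ IsSunflowerKernel R q T := by
  simp [minimalKernels]

/-- This is what permits replacing `R` by its minimal kernels: a set containing none of them
contains no member of `R`. -/
theorem exists_minimalKernels_subset {e : Finset V} (he : IsSunflowerKernel R q e) :
    ∃ S ∈ minimalKernels R q, S ⊆ e := by
  induction e using Finset.strongInduction with
  | H e ih =>
    by_cases h : e ∈ minimalKernels R q
    · exact ⟨e, h, Subset.rfl⟩
    · rw [mem_minimalKernels] at h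
      push Not at h
      obtain ⟨T, hT, hTk⟩ := h he
      obtain ⟨S, hS, hST⟩ := ih T hT hTk
      exact ⟨S, hS, hST.trans hT.1⟩

/-- Few minimal kernels contain a given set of at least two vertices. -/
theorem card_minimalKernels_superset_le (hR : ∀ e, R e → #e = r) (hr : 0 < r) (hq : 0 < q) (k : ℕ)
    (T : Finset V) (hT : 2 ≤ #T) (hk : r ≤ #T + k) :
    #{e ∈ minimalKernels R q | T ⊆ e} ≤ (q * r) ^ k := by
  classical
  induction k generalizing T with
  | zero =>
    have : ({e ∈ minimalKernels R q | T ⊆ e} : Finset (Finset V)) ⊆ {T} := by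
      intro e he
      rw [mem_filter, mem_minimalKernels] at he
      rw [mem_singleton]
      have := he.1.1.card_le hR hq
      exact (Finset.eq_of_subset_of_card_le he.2 (by omega)).symm
    simpa using card_le_card this
  | succ k ih =>
    by_cases hTM : T ∈ minimalKernels R q
    · have : ({e ∈ minimalKernels R q | T ⊆ e} : Finset (Finset V)) ⊆ {T} := by
        intro e he
        rw [mem_filter, mem_minimalKernels] at he
        rw [mem_singleton]
        by_contra hne
        exact he.1.2 T (Finset.ssubset_iff_subset_ne.2 ⟨he.2, fun h => hne h.symm⟩)
          (mem_minimalKernels.1 hTM).1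
      refine (card_le_card this).trans ?_
      rw [card_singleton]
      exact Nat.one_le_pow _ _ (Nat.mul_pos hq hr)
    set A : Finset (Finset V) := {e ∈ minimalKernels R q | T ⊆ e} with hA
    have hAss : ∀ e ∈ A, IsSunflowerKernel R q e ∧ T ⊂ e ∧ e ∈ minimalKernels R q := by
      intro e he
      rw [hA, mem_filter] at he
      refine ⟨(mem_minimalKernels.1 he.1).1, Finset.ssubset_iff_subset_ne.2 ⟨he.2, ?_⟩, he.1⟩
      rintro rfl
      exact hTM he.1
    -- A largest subfamily with disjoint petals over `T` has fewer than `q` members, since otherwise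
    -- `T` would be a kernel strictly inside a minimal one. By maximality every member of `A` meets
    -- the union of these petals, so adding one of at most `q * r` points to `T` covers all cases.
    obtain ⟨P, hP, hPmax⟩ := Finset.exists_max_image
      (A.powerset.filter fun P : Finset (Finset V) =>
        (P : Set (Finset V)).PairwiseDisjoint fun e => e \ T) card ⟨∅, by simp⟩
    rw [mem_filter, mem_powerset] at hP
    have hPq : #P < q := by
      by_contra hcon
      rw [not_lt] at hcon
      obtain ⟨P', hP', hcard⟩ := Finset.exists_subset_card_eq hcon
      let φ := P'.equivFinOfCardEq hcard
      have hmem : ∀ a, (φ.symm a).1 ∈ P := fun a => hP' (φ.symm a).2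
      have hker : IsSunflowerKernel R q T := by
        refine .of_sunflower T (fun a => (φ.symm a).1) hT (fun a => (hAss _ (hP.1 (hmem a))).2.1) ?_
          fun a => (hAss _ (hP.1 (hmem a))).1
        intro a b hab
        exact hP.2 (hmem a) (hmem b) fun h => hab (φ.symm.injective (Subtype.ext h))
      obtain ⟨-, h1, h2⟩ := hAss _ (hP.1 (hmem ⟨0, hq⟩))
      exact (mem_minimalKernels.1 h2).2 T h1 hker
    let X : Finset V := P.biUnion fun e => e \ T
    have hXcard : #X ≤ q * r := by
      refine (card_biUnion_le_card_mul _ _ r fun e he => ?_).trans (Nat.mul_le_mul_right _ hPq.le)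
      exact (card_le_card sdiff_subset).trans ((hAss e (hP.1 he)).1.card_le hR hq)
    have hcover : A ⊆ X.biUnion fun x => {e ∈ minimalKernels R q | insert x T ⊆ e} := by
      intro e he
      obtain ⟨-, hTe, heM⟩ := hAss e he
      have hmeet : ∃ y ∈ X, y ∈ e \ T := by
        by_contra hcon
        push Not at hcon
        obtain ⟨y, hy⟩ := Finset.sdiff_nonempty.2 hTe.2
        have heP : e ∉ P := fun h => hcon y (mem_biUnion.2 ⟨e, h, hy⟩) hy
        have h1 := hPmax (insert e P) (by
          rw [mem_filter, mem_powerset]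
          refine ⟨insert_subset he hP.1, ?_⟩
          rw [coe_insert]
          refine hP.2.insert fun f hf _ => ?_
          rw [Finset.disjoint_left]
          intro z hz hz'
          exact hcon z (mem_biUnion.2 ⟨f, hf, hz'⟩) hz)
        rw [card_insert_of_notMem heP] at h1
        omega
      obtain ⟨y, hyX, hy⟩ := hmeet
      refine mem_biUnion.2 ⟨y, hyX, mem_filter.2 ⟨heM, insert_subset (sdiff_subset hy) hTe.1⟩⟩
    refine (card_le_card hcover).trans ((card_biUnion_le_card_mul _ _ ((q * r) ^ k) ?_).trans ?_)
    · intro y hy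
      obtain ⟨e, -, hye⟩ := mem_biUnion.1 hy
      have hyT : y ∉ T := (mem_sdiff.1 hye).2
      refine ih _ ?_ ?_ <;> rw [card_insert_of_notMem hyT] <;> omega
    · rw [pow_succ, mul_comm]
      exact Nat.mul_le_mul_left _ hXcard

theorem card_minimalKernels_pair_le (hR : ∀ e, R e → #e = r) (hr : 0 < r) (hq : 0 < q) {u v : V}
    (huv : u ≠ v) : #{e ∈ minimalKernels R q | u ∈ e ∧ v ∈ e} ≤ (q * r) ^ r := by
  have := card_minimalKernels_superset_le hR hr hq r {u, v} (by rw [card_pair huv]) (by omega)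
  simpa [insert_subset_iff] using this

/-- The graph of the pairs contained in a member of `M`. -/
def shadowGraph (M : Finset (Finset V)) : SimpleGraph V where
  Adj u v := u ≠ v ∧ ∃ e ∈ M, u ∈ e ∧ v ∈ e
  symm := ⟨fun _ _ h => ⟨h.1.symm, by obtain ⟨e, he, h1, h2⟩ := h.2; exact ⟨e, he, h2, h1⟩⟩⟩
  loopless := ⟨fun _ h => h.1 rfl⟩

/-- The graph of the members of `M` of size two. -/
def pairGraph (M : Finset (Finset V)) : SimpleGraph V where
  Adj u v := u ≠ v ∧ {u, v} ∈ M
  symm := ⟨fun _ _ h => ⟨h.1.symm, by rw [Finset.pair_comm]; exact h.2⟩⟩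
  loopless := ⟨fun _ h => h.1 rfl⟩

open Classical in
/-- If the family `R` has no linear cycle, there are few minimal kernels. -/
theorem exists_card_minimalKernels_le {m : ℕ} (hm : 0 < m) (hr : 2 ≤ r) (hq : 2 * m * r < q) :
    ∃ C : ℝ, 0 < C ∧ ∀ {V : Type} [DecidableEq V] [Fintype V] (R : Finset V → Prop),
      (∀ e, R e → #e = r) → ¬ HasLinearCycle R (2 * m) →
      (#(minimalKernels R q) : ℝ) ≤ C * (Fintype.card V : ℝ) ^ (1 + 1 / (m : ℝ)) := by
  have hq0 : 0 < q := by omega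
  have hne : NeZero (2 * m) := ⟨by omega⟩
  obtain ⟨C, hC, hmain⟩ := SimpleGraph.exists_dartCount_le_of_not_hasConflictFreeCycle hm
    -- A conflict at `w` is caused by one of at most `r` points `y ≠ w` of the earlier label; at
    -- most `(q * r) ^ r` minimal kernels contain `w` and `y`, and each offers at most `r` choices
    -- of `z`.
    (r * ((q * r) ^ r * r))
  refine ⟨(q * r) ^ r * C, by positivity, ?_⟩
  intro V _ _ R hR hno
  set M := minimalKernels R q with hM
  have hMk : ∀ e ∈ M, IsSunflowerKernel R q e := fun e he => (mem_minimalKernels.1 he).1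
  have hlab : ∀ u v, ∃ e : Finset V, #e ≤ r ∧ ((shadowGraph M).Adj u v → e ∈ M ∧ u ∈ e ∧ v ∈ e) := by
    intro u v
    by_cases h : (shadowGraph M).Adj u v
    · obtain ⟨-, e, he, h1, h2⟩ := h
      exact ⟨e, (hMk e he).card_le hR hq0, fun _ => ⟨he, h1, h2⟩⟩
    · exact ⟨∅, by simp, fun h' => absurd h' h⟩
  choose lab hlabr hlab using hlab
  -- With this conflict relation, a conflict-free closed walk together with its labels is a linear
  -- cycle of kernels.
  have h1 := hmain (shadowGraph M) (fun u u' w z => ¬ Disjoint (lab u u' \ {u}) (lab w z \ {w}))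
    (fun a b c d h h' => h h'.symm) univ ?_ ?_
  · have h2 : #M ≤ (q * r) ^ r * (shadowGraph M).dartCount univ univ := by
      have hcov : M ⊆ (univ.sigma fun u => ({v | (shadowGraph M).Adj u v} : Finset V)).biUnion
          fun p => {e ∈ M | p.1 ∈ e ∧ p.2 ∈ e} := by
        intro e he
        obtain ⟨u, hu, v, hv, huv⟩ := Finset.one_lt_card.1 ((hMk e he).two_le_card hR hr)
        refine mem_biUnion.2 ⟨⟨u, v⟩, ?_, mem_filter.2 ⟨he, hu, hv⟩⟩
        simp only [mem_sigma, mem_univ, true_and, mem_filter]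
        exact ⟨huv, e, he, hu, hv⟩
      refine (card_le_card hcov).trans ((card_biUnion_le_card_mul _ _ ((q * r) ^ r) ?_).trans ?_)
      · rintro ⟨u, v⟩ hp
        simp only [mem_sigma, mem_univ, true_and, mem_filter] at hp
        exact card_minimalKernels_pair_le hR (by omega) hq0 hp.1
      · rw [card_sigma, mul_comm]
        rfl
    rw [Finset.card_univ] at h1
    calc (#M : ℝ) ≤ (q * r) ^ r * (shadowGraph M).dartCount univ univ := by exact_mod_cast h2
      _ ≤ (q * r) ^ r * (C * (Fintype.card V : ℝ) ^ (1 + 1 / (m : ℝ))) := by gcongr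
      _ = _ := by ring
  · intro u u' w _
    have hsub : {z | z ∈ (univ : Finset V) ∧ (shadowGraph M).Adj w z ∧
        ¬ Disjoint (lab u u' \ {u}) (lab w z \ {w})} ⊆
        (((lab u u').biUnion fun y => if y = w then ∅ else
          ({e ∈ M | w ∈ e ∧ y ∈ e} : Finset (Finset V)).biUnion id : Finset V) : Set V) := by
      rintro z ⟨-, hwz, hz⟩
      obtain ⟨y, hy, hy'⟩ := Finset.not_disjoint_iff.1 hz
      rw [mem_sdiff, mem_singleton] at hy hy'
      obtain ⟨h1, h2, h3⟩ := hlab w z hwz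
      rw [mem_coe, mem_biUnion]
      refine ⟨y, hy.1, ?_⟩
      rw [if_neg hy'.2, mem_biUnion]
      exact ⟨lab w z, mem_filter.2 ⟨h1, h2, hy'.1⟩, h3⟩
    refine (Set.ncard_le_ncard hsub (Finset.finite_toSet _)).trans ?_
    rw [Set.ncard_coe_finset]
    refine (card_biUnion_le_card_mul _ _ ((q * r) ^ r * r) ?_).trans
      (Nat.mul_le_mul_right _ (hlabr u u'))
    intro y _
    split_ifs with hyw
    · simp
    · refine (card_biUnion_le_card_mul _ _ r fun e he =>
        (hMk e (mem_filter.1 he).1).card_le hR hq0).trans (Nat.mul_le_mul_right _ ?_)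
      exact card_minimalKernels_pair_le hR (by omega) hq0 fun h => hyw h.symm
  · rintro ⟨x, hx, hc⟩
    refine hno (HasLinearCycle.of_isSunflowerKernel hR hq ⟨x, fun i => lab (x i) (x (i + 1)),
      fun i => hMk _ (hlab _ _ (hx i)).1, fun i => (hlab _ _ (hx i)).2.1,
      fun i => (hlab _ _ (hx i)).2.2, fun i => (hx i).1, fun i j hij => ?_⟩)
    exact not_not.1 (hc i j hij)

open Classical in
/-- The Turán bound inside the graph of the minimal kernels of size two. -/
theorem exists_dartCount_pairGraph_le {m : ℕ} (hm : 0 < m) (r q : ℕ) (hq : 2 * m * r < q) :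
    ∃ C : ℝ, 0 < C ∧ ∀ {V : Type} [DecidableEq V] [Fintype V] (R : Finset V → Prop),
      (∀ e, R e → #e = r) → ¬ HasLinearCycle R (2 * m) → ∀ U : Finset V,
      ((pairGraph (minimalKernels R q)).dartCount U U : ℝ) ≤ C * (#U : ℝ) ^ (1 + 1 / (m : ℝ)) := by
  have hne : NeZero (2 * m) := ⟨by omega⟩
  obtain ⟨C, hC, hmain⟩ := SimpleGraph.exists_dartCount_le_of_not_hasConflictFreeCycle hm 1
  refine ⟨C, hC, ?_⟩
  intro V _ _ R hR hno U
  -- Two steps conflict when they end at the same vertex, so a conflict-free closed walk is a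
  -- genuine cycle.
  refine hmain _ (fun _ u' _ z => u' = z) (fun _ _ _ _ h => h.symm) U ?_ ?_
  · intro u u' w _
    refine (Set.ncard_le_ncard (t := {u'}) ?_ (Set.finite_singleton _)).trans (by simp)
    rintro z ⟨-, -, h⟩
    exact h.symm
  · rintro ⟨x, hx, hc⟩
    refine hno (HasLinearCycle.of_isSunflowerKernel hR hq ⟨x, fun i => {x i, x (i + 1)},
      fun i => (mem_minimalKernels.1 (hx i).2).1, fun i => by simp, fun i => by simp,
      fun i => (hx i).1, fun i j hij => ?_⟩)
    have h1 : ∀ i, ({x i, x (i + 1)} : Finset V) \ {x i} = {x (i + 1)} := by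
      intro i
      ext y
      have := (hx i).1
      simp only [mem_sdiff, mem_insert, mem_singleton]
      constructor
      · rintro ⟨h | h, h'⟩
        · exact absurd h h'
        · exact h
      · rintro rfl
        exact ⟨Or.inr rfl, this.symm⟩
    rw [h1, h1, disjoint_singleton]
    exact hc i j hij

end Kernels

/-! ### The independent set in a family without linear cycles. -/

section Independence

set_option maxHeartbeats 1600000 in
open Classical in
/-- A uniform family without linear cycles of length `2m` has a large independent set. -/
theorem exists_independent_of_not_hasLinearCycle {m r : ℕ} (hm : 2 ≤ m) (hr : 2 ≤ r) :
    ∃ c : ℝ, 0 < c ∧ ∃ n₀ : ℝ, ∀ {V : Type} [DecidableEq V] [Fintype V] (R : Finset V → Prop),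
      (∀ e, R e → #e = r) → ¬ HasLinearCycle R (2 * m) → n₀ ≤ Fintype.card V →
      ∃ W : Finset V, (∀ e, R e → ¬ e ⊆ W) ∧
        c * ((Fintype.card V : ℝ) ^ (1 - 1 / (m : ℝ)) * Real.log (Fintype.card V)) ≤ #W := by
  obtain ⟨q₀, hq₀⟩ : ∃ q₀, q₀ = 2 * m * r + 1 := ⟨_, rfl⟩
  have hm0 : 0 < m := by omega
  have hmr : (2 : ℝ) ≤ m := by exact_mod_cast hm
  obtain ⟨C₁, hC₁, hM⟩ := exists_card_minimalKernels_le hm0 hr (q := q₀) (by omega)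
  obtain ⟨C₂, hC₂, hpair⟩ := exists_dartCount_pairGraph_le hm0 r q₀ (by omega)
  obtain ⟨C, hCdef⟩ : ∃ C, C = C₂ + 1 := ⟨_, rfl⟩
  have hC1 : 1 ≤ C := by linarith
  have hC0 : 0 < C := by linarith
  obtain ⟨C₃, hC₃⟩ : ∃ C₃, C₃ = C₁ + 4 * C ^ 3 := ⟨_, rfl⟩
  have hC₃0 : 0 < C₃ := by rw [hC₃]; positivity
  -- Chosen so that `B ^ 2 ≥ 8 * C₃`, which keeps the deletion loss below `n / (8 * q)`.
  obtain ⟨B, hB⟩ : ∃ B, B = 8 * C₃ + 1 := ⟨_, rfl⟩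
  have hB1 : 1 ≤ B := by linarith
  have hB0 : 0 < B := by linarith
  refine ⟨1 / (32768 * C * m), by positivity, B ^ (8 * m), ?_⟩
  intro V _ _ R hR hno hn
  set n : ℝ := (Fintype.card V : ℝ) with hndef
  have hn1 : 1 ≤ n := (one_le_pow₀ hB1).trans hn
  have hn0 : 0 < n := by linarith
  -- In terms of `z` the powers of `n` that matter are integral: degrees are of order `z ^ 8 = n ^
  -- (1/m)`, there are at most order `n * z ^ 12` sets to destroy, and the sampling density is about
  -- `z ^ (-6)`.
  obtain ⟨z, hz⟩ : ∃ z, z = n ^ (((8 * m : ℕ) : ℝ)⁻¹) := ⟨_, rfl⟩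
  have hz1 : 1 ≤ z := by rw [hz]; exact Real.one_le_rpow hn1 (by positivity)
  have hz0 : 0 < z := by linarith
  have hzn : z ^ (8 * m) = n := by rw [hz]; exact Real.rpow_inv_natCast_pow hn0.le (by omega)
  have hzB : B ≤ z := le_of_pow_le_pow_left₀ (by omega : 8 * m ≠ 0) hz0.le (by rw [hzn]; exact hn)
  have hz8 : n ^ (1 / (m : ℝ)) = z ^ 8 := by
    rw [← hzn, pow_mul, one_div]
    exact Real.pow_rpow_inv_natCast (by positivity) (by omega)
  have hnz : n ^ (1 + 1 / (m : ℝ)) = n * z ^ 8 := by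
    rw [Real.rpow_add hn0, Real.rpow_one, hz8]
  have hnz' : n ^ (1 - 1 / (m : ℝ)) = n / z ^ 8 := by
    rw [Real.rpow_sub hn0, Real.rpow_one, hz8]
  have hlog : Real.log n = 8 * m * Real.log z := by
    rw [← hzn, Real.log_pow]; push_cast; ring
  clear_value n
  set M := minimalKernels R q₀ with hMdef
  set G := pairGraph M with hG
  have hpair' : ∀ U : Finset V, (G.dartCount U U : ℝ) ≤ C * (#U : ℝ) ^ (1 + 1 / (m : ℝ)) := by
    intro U
    refine (hpair R hR hno U).trans ?_
    gcongr
    linarith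
  have hMcard : (#M : ℝ) ≤ C₁ * (n * z ^ 8) := by rw [← hnz, hndef]; exact hM R hR hno
  -- vertices of low degree
  obtain ⟨U, -, hUcard, hUdeg⟩ := G.exists_subset_degree_le univ (D := C * z ^ 8) (by positivity) (by
    have := hpair' univ
    rw [Finset.card_univ, ← hndef, hnz] at this
    rw [Finset.card_univ, ← hndef]
    linarith)
  rw [Finset.card_univ, ← hndef] at hUcard
  obtain ⟨Δ, hΔ⟩ : ∃ Δ, Δ = 2 * (C * z ^ 8) := ⟨_, rfl⟩
  rw [← hΔ] at hUdeg
  have hΔ0 : 0 < Δ := by rw [hΔ]; positivity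
  have hUn : (#U : ℝ) ≤ n := by rw [hndef]; exact_mod_cast card_le_univ U
  -- triangles
  let N : V → Finset V := fun u => {v | G.Adj u v}
  let T₃ : Finset (Finset V) := (U.sigma fun u => (N u).sigma fun v => ({w ∈ N u | G.Adj v w})).image
    fun p => {p.1, p.2.1, p.2.2}
  have hT₃mem : ∀ u ∈ U, ∀ v w, G.Adj u v → G.Adj v w → G.Adj u w → ({u, v, w} : Finset V) ∈ T₃ := by
    intro u hu v w h1 h2 h3
    exact mem_image.2 ⟨⟨u, v, w⟩, by simp [N, hu, h1, h2, h3], rfl⟩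
  have hT₃3 : ∀ t ∈ T₃, 3 ≤ #t := by
    intro t ht
    obtain ⟨⟨u, v, w⟩, hp, rfl⟩ := mem_image.1 ht
    simp only [N, mem_sigma, mem_filter, mem_univ, true_and] at hp
    rw [card_eq_three.2 ⟨u, v, w, hp.2.1.ne, hp.2.2.1.ne, hp.2.2.2.ne, rfl⟩]
  have hT₃card : (#T₃ : ℝ) ≤ n * (4 * C ^ 3 * z ^ 12) := by
    have h1 : #T₃ ≤ ∑ u ∈ U, G.dartCount (N u) (N u) := by
      refine card_image_le.trans (le_of_eq ?_)
      simp only [card_sigma, SimpleGraph.dartCount]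
    have h2 : ∀ u ∈ U, (G.dartCount (N u) (N u) : ℝ) ≤ 4 * C ^ 3 * z ^ 12 := by
      intro u hu
      refine (hpair' (N u)).trans ?_
      have h3 : (#(N u) : ℝ) ≤ Δ := hUdeg u hu
      have h4 : (0 : ℝ) ≤ 1 / m := by positivity
      -- From `m ≥ 2`, a neighbourhood spans at most order `Δ ^ (3/2)` edges, whence the exponent
      -- `12 = 8 * 3/2`.
      have h5 : (1 : ℝ) / m ≤ 1 / 2 := one_div_le_one_div_of_le (by norm_num) hmr
      have h6 : (#(N u) : ℝ) ^ (1 + 1 / (m : ℝ)) ≤ Δ ^ (1 + 1 / (m : ℝ)) :=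
        Real.rpow_le_rpow (Nat.cast_nonneg _) h3 (by positivity)
      have h7 : Δ ^ (1 + 1 / (m : ℝ)) ≤ 4 * C ^ 2 * z ^ 12 := by
        rw [hΔ, ← mul_assoc, Real.mul_rpow (by positivity) (by positivity)]
        have h8 : (2 * C) ^ (1 + 1 / (m : ℝ)) ≤ 4 * C ^ 2 := by
          calc (2 * C) ^ (1 + 1 / (m : ℝ)) ≤ (2 * C) ^ (2 : ℝ) :=
                Real.rpow_le_rpow_of_exponent_le (by linarith) (by linarith)
            _ = 4 * C ^ 2 := by rw [Real.rpow_two]; ring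
        have h9 : (z ^ 8) ^ (1 + 1 / (m : ℝ)) ≤ z ^ 12 := by
          calc (z ^ 8) ^ (1 + 1 / (m : ℝ)) ≤ (z ^ 8) ^ (3 / 2 : ℝ) :=
                Real.rpow_le_rpow_of_exponent_le (one_le_pow₀ hz1) (by linarith)
            _ = z ^ 12 := by
                rw [← Real.rpow_natCast z 8, ← Real.rpow_mul hz0.le, ← Real.rpow_natCast z 12]
                norm_num
        gcongr
      calc C * (#(N u) : ℝ) ^ (1 + 1 / (m : ℝ)) ≤ C * (4 * C ^ 2 * z ^ 12) := by
            gcongr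
            exact h6.trans h7
        _ = _ := by ring
    calc (#T₃ : ℝ) ≤ ∑ u ∈ U, (G.dartCount (N u) (N u) : ℝ) := by exact_mod_cast h1
      _ ≤ #U * (4 * C ^ 3 * z ^ 12) := by
          refine (Finset.sum_le_sum h2).trans (le_of_eq ?_)
          rw [sum_const, nsmul_eq_mul]
      _ ≤ _ := by gcongr
  set T : Finset (Finset V) := {e ∈ M | 3 ≤ #e} ∪ T₃ with hT
  have hT3 : ∀ t ∈ T, 3 ≤ #t := by
    intro t ht
    rcases mem_union.1 ht with h | h
    · exact (mem_filter.1 h).2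
    · exact hT₃3 t h
  have hTcard : (#T : ℝ) ≤ n * (C₃ * z ^ 12) := by
    have h1 : (#T : ℝ) ≤ #M + #T₃ := by
      exact_mod_cast (card_union_le _ _).trans (Nat.add_le_add_right (card_filter_le _ _) _)
    have h2 : z ^ 8 ≤ z ^ 12 := pow_le_pow_right₀ hz1 (by norm_num)
    have h3 : C₁ * (n * z ^ 8) ≤ C₁ * (n * z ^ 12) := by gcongr
    rw [hC₃]
    linarith
  have hE : (G.dartCount U U : ℝ) ≤ n * Δ := by
    have h1 : ∀ u ∈ U, (#{v ∈ U | G.Adj u v} : ℝ) ≤ Δ := fun u hu =>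
      le_trans (by exact_mod_cast card_le_card (filter_subset_filter _ (subset_univ _))) (hUdeg u hu)
    rw [SimpleGraph.dartCount]
    push_cast
    refine (Finset.sum_le_sum h1).trans ?_
    rw [sum_const, nsmul_eq_mul]
    gcongr
  -- sampling
  obtain ⟨q, hqdef⟩ : ∃ q, q = ⌈B * z ^ 6⌉₊ := ⟨_, rfl⟩
  have hqlow : B * z ^ 6 ≤ q := by rw [hqdef]; exact Nat.le_ceil _
  have hBz : 1 ≤ B * z ^ 6 := one_le_mul_of_one_le_of_one_le hB1 (one_le_pow₀ hz1)
  have hqup : (q : ℝ) ≤ 2 * (B * z ^ 6) := by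
    rw [hqdef]
    have := Nat.ceil_lt_add_one (a := B * z ^ 6) (by linarith)
    linarith
  have hq0' : (0 : ℝ) < q := by linarith
  have hq0 : 0 < q := by exact_mod_cast hq0'
  -- The coefficient is balanced so that the edge term, like the deletion term, costs at most `n /
  -- (8 * q)` of the expected `n / (2 * q)` vertices.
  obtain ⟨S, hSU, hST, hScard, hSdart⟩ := G.exists_sparse_subset U T hT3 hq0 (c := q / (8 * Δ))
    (X := n / (4 * q)) (by positivity) (by positivity) (by
      have h1 : n / 2 / q ≤ #U / q := by gcongr
      have h2 : (#T : ℝ) / q ^ 3 ≤ n / (8 * q) := by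
        rw [div_le_div_iff₀ (by positivity) (by positivity)]
        have h3 : 8 * (C₃ * z ^ 12) ≤ q ^ 2 := by
          calc 8 * (C₃ * z ^ 12) ≤ B * B * z ^ 12 := by
                have : 8 * C₃ ≤ B * B := by nlinarith
                nlinarith [pow_pos hz0 12]
            _ = (B * z ^ 6) ^ 2 := by ring
            _ ≤ q ^ 2 := by gcongr
        calc (#T : ℝ) * (8 * q) ≤ n * (C₃ * z ^ 12) * (8 * q) := by gcongr
          _ = n * (8 * (C₃ * z ^ 12)) * q := by ring
          _ ≤ n * q ^ 2 * q := by gcongr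
          _ = n * q ^ 3 := by ring
      have h4 : (q : ℝ) / (8 * Δ) * G.dartCount U U / q ^ 2 ≤ n / (8 * q) := by
        calc (q : ℝ) / (8 * Δ) * G.dartCount U U / q ^ 2 ≤ (q : ℝ) / (8 * Δ) * (n * Δ) / q ^ 2 := by
              gcongr
          _ = n / (8 * q) := by field_simp
      have h5 : n / 2 / q - n / (8 * q) - n / (8 * q) = n / (4 * q) := by field_simp; norm_num
      linarith)
  obtain ⟨W₀, hW₀S, hW₀card, hW₀deg⟩ := G.exists_subset_degree_le S (D := 8 * Δ / q) (by positivity) (by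
    have h1 : (G.dartCount S S : ℝ) = q / (8 * Δ) * G.dartCount S S * (8 * Δ / q) := by field_simp
    rw [h1, mul_comm (8 * Δ / (q : ℝ))]
    gcongr)
  obtain ⟨D, hD⟩ : ∃ D, D = 2 * (8 * Δ / q) := ⟨_, rfl⟩
  rw [← hD] at hW₀deg
  -- In fact `D` has order `z ^ 2`; a fixed positive power of `n` is enough to make `log D` of order
  -- `log n`.
  have hDz : z ≤ D := by
    rw [hD, hΔ, ← mul_div_assoc, le_div_iff₀ hq0']
    calc z * q ≤ z * (2 * (B * z ^ 6)) := by gcongr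
      _ ≤ z * (2 * (z * z ^ 6)) := by gcongr
      _ = 2 * z ^ 8 := by ring
      _ ≤ 2 * (8 * (2 * (C * z ^ 8))) := by nlinarith [pow_pos hz0 8]
  have hW₀deg' : ∀ v ∈ W₀, (#{z ∈ W₀ | G.Adj v z} : ℝ) ≤ D := fun v hv =>
    le_trans (by exact_mod_cast card_le_card (filter_subset_filter _ hW₀S)) (hW₀deg v hv)
  obtain ⟨W, hWW₀, hWind, hWcard⟩ := G.exists_isIndepSet_of_triangleFree W₀ (hz1.trans hDz) hW₀deg' (by
    intro u hu v hv w hw h1 h2 h3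
    refine hST {u, v, w} (mem_union_right _ (hT₃mem u (hSU (hW₀S hu)) v w h1 h2 h3)) ?_
    intro y hy
    simp only [mem_insert, mem_singleton] at hy
    rcases hy with rfl | rfl | rfl
    · exact hW₀S hu
    · exact hW₀S hv
    · exact hW₀S hw)
  refine ⟨W, ?_, ?_⟩
  · intro e he heW
    obtain ⟨F, hF, hFe⟩ := exists_minimalKernels_subset (q := q₀) (IsSunflowerKernel.of_mem e he)
    have hF2 := (mem_minimalKernels.1 hF).1.two_le_card hR hr
    rcases hF2.eq_or_lt with h2 | h2
    · obtain ⟨u, v, huv, rfl⟩ := card_eq_two.1 h2.symm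
      exact hWind u (heW (hFe (by simp))) v (heW (hFe (by simp))) ⟨huv, hF⟩
    · exact hST F (mem_union_left _ (mem_filter.2 ⟨hF, h2⟩))
        ((hFe.trans heW).trans (hWW₀.trans hW₀S))
  · refine le_trans ?_ hWcard
    have hlz : Real.log z ≤ Real.log D := Real.log_le_log hz0 hDz
    have hlz0 : 0 ≤ Real.log z := Real.log_nonneg hz1
    have h1 : n / (8 * q) ≤ #W₀ := by
      have : n / (8 * q) = n / (4 * q) / 2 := by field_simp; norm_num
      linarith
    -- Here `D = 32 * C * z ^ 8 / q`, so `q` cancels, and `32768 = 8 * 16 * 32 * 8`, the last `8`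
    -- coming from `log n = 8 * m * log z`.
    calc 1 / (32768 * C * m) * (n ^ (1 - 1 / (m : ℝ)) * Real.log n)
        = n / (8 * q) * Real.log z / (16 * D) := by
          rw [hnz', hlog, hD, hΔ]; field_simp; ring
      _ ≤ #W₀ * Real.log D / (16 * D) := by
          have : 0 < D := hz0.trans_le hDz
          gcongr

end Independence

/-! ### From set families back to colourings. -/

section Ramsey

namespace Hypergraph

/-- The edges of colour `b`, as finite sets. -/
def colorFamily {r n : ℕ} (c : (completeUniform r n).edgeSet → Bool) (b : Bool)
    (e : Finset (Fin n)) : Prop :=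
  (e : Set (Fin n)) ∈ (colorClass c b).edgeSet

theorem colorFamily.card_eq {r n : ℕ} {c : (completeUniform r n).edgeSet → Bool} {b : Bool}
    {e : Finset (Fin n)} (h : colorFamily c b e) : #e = r := by
  obtain ⟨he, -⟩ := h
  have : (e : Set (Fin n)).ncard = r := he
  rwa [Set.ncard_coe_finset] at this

/-- A linear cycle in a colour class gives a copy of the `r`-uniform linear cycle. -/
theorem containsCopy_linearCycle {r n ℓ : ℕ} (hr : 2 ≤ r)
    {c : (completeUniform r n).edgeSet → Bool} {b : Bool}
    (h : HasLinearCycle (colorFamily c b) ℓ) :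
    (colorClass c b).ContainsCopy (linearCycle r ℓ) := by
  obtain ⟨x, e, he, hx, hx', hne, hd⟩ := h
  let P : ZMod ℓ → Finset (Fin n) := fun i => e i \ {x i}
  have hcard : ∀ i, #(P i) = r - 1 := by
    intro i
    rw [Finset.card_sdiff_of_subset (singleton_subset_iff.2 (hx i)), (he i).card_eq, card_singleton]
  have hmem : ∀ i, x (i + 1) ∈ P i := fun i => mem_sdiff.2 ⟨hx' i, by
    rw [mem_singleton]; exact (hne i).symm⟩
  let z : Fin (r - 1) := ⟨0, by omega⟩
  have hg : ∀ i, ∃ g : Fin (r - 1) ≃ P i, g z = ⟨x (i + 1), hmem i⟩ := by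
    intro i
    let g₀ := ((P i).equivFinOfCardEq (hcard i)).symm
    exact ⟨g₀.trans (Equiv.swap (g₀ z) ⟨x (i + 1), hmem i⟩), by simp⟩
  choose g hg using hg
  -- The orientation is reversed: block `i` of the model contains the core vertex shared with edge
  -- `i - 1`, whereas `P i` contains `x (i + 1)`, shared with `e (i + 1)`. Edge `i` goes to `e (-i -
  -- 1)`.
  let f : ZMod ℓ × Fin (r - 1) → Fin n := fun p => g (-p.1 - 1) p.2
  have hf0 : ∀ i, f (i, z) = x (-i) := by
    intro i
    simp only [f, hg]
    congr 1
    ring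
  refine ⟨f, ?_, fun _ _ => Set.mem_univ _, ?_⟩
  · rintro ⟨i, a⟩ - ⟨j, b⟩ - hab
    have hij : i = j := by
      by_contra hne
      have hne' : -i - 1 ≠ -j - 1 := fun h => hne (neg_injective (sub_left_injective h))
      have h1 : f (i, a) ∈ P (-i - 1) := (g (-i - 1) a).2
      have h2 : f (j, b) ∈ P (-j - 1) := (g (-j - 1) b).2
      rw [hab] at h1
      exact Finset.disjoint_left.1 (hd _ _ hne') h1 h2
    subst hij
    have : a = b := (g (-i - 1)).injective (Subtype.ext hab)
    rw [this]
  · rintro _ ⟨i, rfl⟩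
    have himage : f '' linearCycleEdge r ℓ i = (e (-i - 1) : Set (Fin n)) := by
      ext y
      constructor
      · rintro ⟨⟨j, a⟩, hja, rfl⟩
        rcases hja with h | ⟨h, h'⟩
        · simp only at h
          subst h
          exact (mem_sdiff.1 (g (-j - 1) a).2).1
        · simp only at h h'
          subst h
          have : a = z := Fin.ext h'
          rw [this, hf0, mem_coe]
          have h2 := hx (-i - 1)
          rwa [show -i - 1 = -(i + 1) by ring] at h2 ⊢
      · intro hy
        by_cases hyx : y = x (-i - 1)
        · refine ⟨(i + 1, z), Or.inr ⟨rfl, rfl⟩, ?_⟩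
          rw [hf0, hyx]
          congr 1
          ring
        · refine ⟨(i, (g (-i - 1)).symm ⟨y, mem_sdiff.2 ⟨hy, by simpa using hyx⟩⟩), Or.inl rfl, ?_⟩
          simp [f]
    rw [himage]
    exact he _

/-- A large set without red edges gives a blue complete `r`-graph. -/
theorem containsCopy_completeUniform {r n t : ℕ} {c : (completeUniform r n).edgeSet → Bool}
    {W : Finset (Fin n)} (hW : ∀ e, colorFamily c true e → ¬ e ⊆ W) (ht : t ≤ #W) :
    (colorClass c false).ContainsCopy (completeUniform r t) := by
  classical
  obtain ⟨W', hW', hcard⟩ := Finset.exists_subset_card_eq ht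
  let g := (W'.equivFinOfCardEq hcard).symm
  have hinj : Function.Injective fun i => (g i : Fin n) :=
    Subtype.val_injective.comp g.injective
  refine ⟨fun i => g i, hinj.injOn, fun _ _ => Set.mem_univ _, ?_⟩
  intro e he
  have hcard' : ((fun i => (g i : Fin n)) '' e).ncard = r := by
    rw [Set.ncard_image_of_injective _ hinj]; exact he
  refine ⟨hcard', ?_⟩
  rw [← Bool.not_eq_true]
  intro hcol
  refine hW ((fun i => (g i : Fin n)) '' e).toFinset ?_ ?_
  · rw [colorFamily, Set.coe_toFinset]
    exact ⟨hcard', hcol⟩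
  · intro y hy
    rw [Set.mem_toFinset] at hy
    obtain ⟨i, -, rfl⟩ := hy
    exact hW' (g i).2

end Hypergraph

end Ramsey

theorem theorem7p10 (m r : ℕ) (hm : 2 ≤ m) (hr : 3 ≤ r) :
    ∃ a : ℝ, 0 < a ∧ ∀ t : ℕ, 2 ≤ t →
      ∃ N : ℕ,
        Hypergraph.IsRamseyNumber r (Hypergraph.linearCycle r (2 * m))
          (Hypergraph.completeUniform r t) N ∧
        (N : ℝ) ≤ a * ((t : ℝ) / Real.log (t : ℝ)) ^ ((m : ℝ) / ((m : ℝ) - 1)) := by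
  obtain ⟨c, hc, n₀, hmain⟩ := exists_independent_of_not_hasLinearCycle hm (by omega : 2 ≤ r)
  have hmr : (2 : ℝ) ≤ m := by exact_mod_cast hm
  set β : ℝ := (m : ℝ) / ((m : ℝ) - 1) with hβ
  have hm1 : (0 : ℝ) < m - 1 := by linarith
  have hβ1 : 1 ≤ β := by rw [hβ, le_div_iff₀ hm1]; linarith
  have hβinv : 1 - 1 / (m : ℝ) = β⁻¹ := by rw [hβ]; field_simp
  have hβ0 : 0 < β := by linarith
  -- The factor `2 / c` compensates for `c` and for the loss of one half in `log n ≥ log t / 2`; the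
  -- summand `|n₀|` in `A` makes `n` reach the threshold.
  set L : ℝ := 2 / c + 1 with hL
  have hL1 : 1 ≤ L := by rw [hL]; linarith [show 0 < 2 / c by positivity]
  have hL0 : 0 < L := by linarith
  set A : ℝ := L ^ β + |n₀| with hA
  have hLA : L ^ β ≤ A := by rw [hA]; linarith [abs_nonneg n₀]
  have hA1 : 1 ≤ A := (Real.one_le_rpow hL1 hβ0.le).trans hLA
  have hAn : n₀ ≤ A := by
    rw [hA]; linarith [le_abs_self n₀, Real.rpow_pos_of_pos hL0 β]
  refine ⟨2 * A, by linarith, fun t ht => ?_⟩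
  have ht2 : (2 : ℝ) ≤ t := by exact_mod_cast ht
  have ht0 : (0 : ℝ) < t := by linarith
  have hlog0 : 0 < Real.log t := Real.log_pos (by linarith)
  have hsqrt : √(t : ℝ) * √t = t := Real.mul_self_sqrt ht0.le
  have hsqrt0 : 0 < √(t : ℝ) := Real.sqrt_pos.2 ht0
  have hsqrt1 : 1 ≤ √(t : ℝ) := by rw [Real.one_le_sqrt]; linarith
  -- With `s` the fourth root of `t`, `log t ≤ 4 * (s - 1) ≤ s ^ 2`. It gives `t / log t ≥ √t`, and
  -- hence `log n ≥ log t / 2` below.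
  have hlogsqrt : Real.log t ≤ √t := by
    have h1 : Real.log t = 4 * Real.log √√t := by
      rw [Real.log_sqrt hsqrt0.le, Real.log_sqrt ht0.le]; ring
    have h2 : √√(t : ℝ) * √√t = √t := Real.mul_self_sqrt hsqrt0.le
    have h3 := Real.log_le_sub_one_of_pos (Real.sqrt_pos.2 hsqrt0)
    nlinarith [sq_nonneg (√√(t : ℝ) - 2)]
  set y : ℝ := (t : ℝ) / Real.log t with hy
  have hyt : √(t : ℝ) ≤ y := by
    rw [hy, le_div_iff₀ hlog0]
    calc √(t : ℝ) * Real.log t ≤ √t * √t := by gcongr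
      _ = t := hsqrt
  have hy1 : 1 ≤ y := hsqrt1.trans hyt
  have hy0 : 0 < y := by linarith
  have hyβ : y ≤ y ^ β := Real.self_le_rpow_of_one_le hy1 hβ1
  have hA0 : 0 < A := by linarith
  have hAy : 1 ≤ A * y ^ β := one_le_mul_of_one_le_of_one_le hA1 (hy1.trans hyβ)
  obtain ⟨n, hn⟩ : ∃ n, n = ⌈A * y ^ β⌉₊ := ⟨_, rfl⟩
  have hnlow : A * y ^ β ≤ n := by rw [hn]; exact Nat.le_ceil _
  have hnup : (n : ℝ) ≤ 2 * A * y ^ β := by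
    rw [hn]
    have := Nat.ceil_lt_add_one (a := A * y ^ β) (by linarith)
    linarith
  have hn1 : (1 : ℝ) ≤ n := hAy.trans hnlow
  have hnpos : 0 < n := by
    have : (0 : ℝ) < n := by linarith
    exact_mod_cast this
  have harrow : Hypergraph.RamseyArrow r n (Hypergraph.linearCycle r (2 * m))
      (Hypergraph.completeUniform r t) := by
    intro col
    by_cases hcyc : HasLinearCycle (Hypergraph.colorFamily col true) (2 * m)
    · exact Or.inl (Hypergraph.containsCopy_linearCycle (by omega) hcyc)
    · right
      obtain ⟨W, hW, hWcard⟩ := hmain (Hypergraph.colorFamily col true)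
        (fun e he => he.card_eq) hcyc (by
          rw [Fintype.card_fin]
          have : A * 1 ≤ A * y ^ β := by gcongr; exact hy1.trans hyβ
          linarith)
      rw [Fintype.card_fin] at hWcard
      refine Hypergraph.containsCopy_completeUniform hW ?_
      have h1 : L * y ≤ (n : ℝ) ^ (1 - 1 / (m : ℝ)) := by
        rw [hβinv, Real.le_rpow_inv_iff_of_pos (by positivity) (by linarith) hβ0,
          Real.mul_rpow hL0.le hy0.le]
        refine le_trans ?_ hnlow
        gcongr
      have h2 : Real.log t / 2 ≤ Real.log n := by
        rw [← Real.log_sqrt ht0.le]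
        refine Real.log_le_log hsqrt0 ?_
        have : 1 * y ^ β ≤ A * y ^ β := by gcongr
        linarith
      have h3 : (t : ℝ) ≤ #W := by
        refine le_trans ?_ hWcard
        calc (t : ℝ) = c * ((2 / c) * y * (Real.log t / 2)) := by rw [hy]; field_simp
          _ ≤ c * (L * y * (Real.log t / 2)) := by gcongr; rw [hL]; linarith
          _ ≤ _ := by gcongr
      exact_mod_cast h3
  classical
  have hex : ∃ n, 0 < n ∧ Hypergraph.RamseyArrow r n (Hypergraph.linearCycle r (2 * m))
      (Hypergraph.completeUniform r t) := ⟨n, hnpos, harrow⟩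
  refine ⟨Nat.find hex, ⟨Nat.find_spec hex, fun k hk => Nat.find_min' hex hk⟩, ?_⟩
  refine le_trans ?_ hnup
  exact_mod_cast Nat.find_min' hex ⟨hnpos, harrow⟩
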